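/- **Lemma (Virtual upper bound).** Let $m_1=m_1(n)$ and $m_2=m_2(n)$ be proportional to $n$, i.e. $m_1/n\to\alpha_1$ and $m_2/n\to\alpha_2$ with constants $\alpha_1,\alpha_2$ independent of $n$ (for instance $m_i=\alpha_i n$ for those $n$ for which these are integers). For each $n$ let $A\in\mathbb R^{m_1\times n}$ and $B\in\mathbb R^{m_2\times n}$ be random matrices all of whose entries are i.i.d. standard normal, let $g\in\mathbb R^n$ be a random vector with i.i.d. standard normal entries, and let $f=f_n:\mathbb R^n\to\mathbb R$ be a given function. Events $E_n$ hold *with overwhelming probability* if there is a constant $c>0$, independent of $n$, with $P(E_n)\ge 1-e^{-cn}$ for all large $n$. Let $$\xi(f,A,B)=\inf\{f(x): x\in\mathbb R^n,\ Ax=0,\ Bx\le 0\}\in[-\infty,\infty].$$ Assume that, with overwhelming probability, $|\xi(f,A,B)|<\infty$ and that, with overwhelming probability, strong duality holds: $$\xi(f,A,B)=\inf_{x}\ \sup_{\lambda\ge0,\ \nu}\bigl(f(x)+\nu^TAx+\lambda^TBx\bigr)=\sup_{\lambda\ge0,\ \nu}\ \inf_{x}\bigl(f(x)+\nu^TAx+\lambda^TBx\bigr),$$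 where $\nu\in\mathbb R^{m_1}$ and $\lambda\in\mathbb R^{m_2}$. Let $\varepsilon_1,\varepsilon_5>0$ be arbitrary constants independent of $n$, let $\xi_D^{(u)}(f)=\xi_D^{(u)}(f_n)\in\mathbb R$, and put $$U^{(1)}=\inf\Bigl\{f(x)-\xi_D^{(u)}(f):\ x\in\mathbb R^n,\ -g^Tx+\|x\|_2\bigl((1+\varepsilon_1)\sqrt{m_1+m_2/2}+\varepsilon_5\sqrt n\bigr)\le0\Bigr\}.$$ If the scalars $\xi_D^{(u)}(f)$ are such that $U^{(1)}\le 0$ with overwhelming probability (in particular, if they are the smallest such scalars), then $$\lim_{n\to\infty}P\bigl(\xi(f,A,B)\le\xi_D^{(u)}(f)\bigr)=1.$$ If moreover $U^{(1)}<0$ with overwhelming probability, then $$\lim_{n\to\infty}P\bigl(\xi(f,A,B)<\xi_D^{(u)}(f)\bigr)=1.$$ -/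

import Mathlib

open MeasureTheory ProbabilityTheory Filter Topology Matrix

noncomputable section

namespace RandomDuality

/-- The law of a vector with `n` i.i.d. standard normal components. -/
def gaussianVector (n : ℕ) : Measure (Fin n → ℝ) :=
  Measure.pi fun _ => gaussianReal 0 1

/-- The law of an `m × n` matrix with i.i.d. standard normal components, given by its
rows (turned into a `Matrix` by `Matrix.of`). -/
def gaussianMatrix (m n : ℕ) : Measure (Fin m → Fin n → ℝ) :=
  Measure.pi fun _ => Measure.pi fun _ => gaussianReal 0 1

/-- The joint law of `(A, B)` when all components of the `m₁ × n` matrix `A` and of the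
`m₂ × n` matrix `B` are i.i.d. standard normal. -/
def gaussianPair (m₁ m₂ n : ℕ) :
    Measure ((Fin m₁ → Fin n → ℝ) × (Fin m₂ → Fin n → ℝ)) :=
  (gaussianMatrix m₁ n).prod (gaussianMatrix m₂ n)

/-- The events `E n` hold with overwhelming probability: the probability of failure is at most
`exp (-c n)` for all large `n`, with a constant `c > 0` independent of `n`. -/
def WithOverwhelmingProbability {Ω : ℕ → Type} [∀ n, MeasurableSpace (Ω n)]
    (P : ∀ n, Measure (Ω n)) (E : ∀ n, Set (Ω n)) : Prop :=
  ∃ c : ℝ, 0 < c ∧ ∀ᶠ n : ℕ in atTop, P n (E n)ᶜ ≤ ENNReal.ofReal (Real.exp (-(c * n)))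

/-- The optimal value `ξ(f, A, B)` of: minimize `f x` subject to `A x = 0` and `B x ≤ 0`. -/
def optValue {m₁ m₂ n : ℕ} (f : EuclideanSpace ℝ (Fin n) → ℝ)
    (A : Matrix (Fin m₁) (Fin n) ℝ) (B : Matrix (Fin m₂) (Fin n) ℝ) : EReal :=
  ⨅ (x : EuclideanSpace ℝ (Fin n)) (_ : A *ᵥ x.ofLp = 0 ∧ B *ᵥ x.ofLp ≤ 0), (f x : EReal)

/-- The Lagrangian `f x + νᵀ A x + lᵀ B x`. -/
def lagrangian {m₁ m₂ n : ℕ} (f : EuclideanSpace ℝ (Fin n) → ℝ)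
    (A : Matrix (Fin m₁) (Fin n) ℝ) (B : Matrix (Fin m₂) (Fin n) ℝ)
    (x : EuclideanSpace ℝ (Fin n)) (ν : Fin m₁ → ℝ) (l : Fin m₂ → ℝ) : ℝ :=
  f x + ν ⬝ᵥ (A *ᵥ x.ofLp) + l ⬝ᵥ (B *ᵥ x.ofLp)

/-- Strong duality: `ξ(f, A, B)` is the min-max and also the max-min of the Lagrangian, the
multipliers `l` of the inequality constraints being nonnegative. -/
def StrongDuality {m₁ m₂ n : ℕ} (f : EuclideanSpace ℝ (Fin n) → ℝ)
    (A : Matrix (Fin m₁) (Fin n) ℝ) (B : Matrix (Fin m₂) (Fin n) ℝ) : Prop :=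
  optValue f A B =
      ⨅ x : EuclideanSpace ℝ (Fin n), ⨆ (ν : Fin m₁ → ℝ) (l : Fin m₂ → ℝ) (_ : 0 ≤ l),
        (lagrangian f A B x ν l : EReal) ∧
  optValue f A B =
      ⨆ (ν : Fin m₁ → ℝ) (l : Fin m₂ → ℝ) (_ : 0 ≤ l), ⨅ x : EuclideanSpace ℝ (Fin n),
        (lagrangian f A B x ν l : EReal)

/-- The optimal value `U⁽¹⁾` of the auxiliary program with level `t`: minimize `f x - t` subject to
`-gᵀ x + ‖x‖ ((1 + ε₁) √(m₁ + m₂ / 2) + ε₅ √n) ≤ 0`. -/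
def auxValue {n : ℕ} (m₁ m₂ : ℕ) (ε₁ ε₅ : ℝ) (f : EuclideanSpace ℝ (Fin n) → ℝ) (t : ℝ)
    (g : Fin n → ℝ) : EReal :=
  ⨅ (x : EuclideanSpace ℝ (Fin n))
    (_ : -(g ⬝ᵥ x.ofLp) +
      ‖x‖ * ((1 + ε₁) * √((m₁ : ℝ) + (m₂ : ℝ) / 2) + ε₅ * √(n : ℝ)) ≤ 0),
    ((f x - t : ℝ) : EReal)

end RandomDuality

end

/-! Suppose that strong duality holds and `ξ > t`. Then some multiplier `y = (ν, l)` with `l ≥ 0`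
keeps the Lagrangian `f x + yᵀ C x` above a level larger than `t` for every `x`, where `C` stacks
`A` and `B`. This is an event of the form "exists `y`, for all `x`" for a bilinear Gaussian process,
which is the setting of Gordon's comparison inequality.

Add to `yᵀ C x` the term `‖x‖ ‖y‖ g₀`, with `g₀` standard normal and independent of `C`. On `g₀ > 0`
this only helps, and by independence it costs the fixed factor `P(g₀ > 0)`. Gordon's inequality
(`measure_exists_forall_le`, specialised in `measure_bilinear_le_measure_linear`) then passes to the
decoupled process `‖x‖ hᵀ y - ‖y‖ gᵀ x`. Since `l ≥ 0`, `hᵀ y` is at most `‖y‖` times the norm of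
the projection of `h` onto a cone. The square of that norm has mean `m₁ + m₂ / 2` and variance
`O(n)`, so with high probability it is below `s ^ 2`, for an `s` slightly smaller than the
coefficient of `‖x‖` in the auxiliary program. On that event no `x` with `‖x‖ s ≤ gᵀ x` can have a
value of `f` at or below the level, whereas the assumption on `U⁽¹⁾` supplies such an `x` with high
probability. Hence `P(ξ > t) P(g₀ > 0)` is bounded by vanishing quantities.

Gordon's inequality is proved for finite index sets, by Gaussian interpolation. Dense sequences of
multipliers and of points of the graph of `f` remove the finiteness; the gap between `s` and the
true coefficient absorbs the approximation, so `f` needs no regularity. -/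

namespace RandomDuality

/-! ### Gaussian integration by parts. -/

section Stein

/-- The standard Gaussian measure on `κ → ℝ`. -/
noncomputable abbrev stdGaussianPi (κ : Type*) [Fintype κ] : Measure (κ → ℝ) :=
  Measure.pi fun _ => gaussianReal 0 1

lemma hasDerivAt_gaussianPDFReal (x : ℝ) :
    HasDerivAt (gaussianPDFReal 0 1) (-(x * gaussianPDFReal 0 1 x)) x := by
  have h : gaussianPDFReal 0 1 = fun x => (√(2 * Real.pi))⁻¹ * Real.exp (-(x ^ 2) / 2) := by
    funext x; simp [gaussianPDFReal]
  rw [h]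
  have h1 : HasDerivAt (fun x : ℝ => -(x ^ 2) / 2) (-x) x := by
    have := ((hasDerivAt_pow 2 x).neg).div_const 2
    convert! this using 1
    simp; ring
  convert! (h1.exp.const_mul (√(2 * Real.pi))⁻¹) using 1
  ring

lemma integrable_bounded_gaussianReal {u : ℝ → ℝ} (hu : Continuous u) {K : ℝ}
    (hK : ∀ x, |u x| ≤ K) : Integrable u (gaussianReal 0 1) :=
  Integrable.of_bound hu.aestronglyMeasurable K (ae_of_all _ fun x => by simpa using hK x)

lemma integrable_id_mul_bounded_gaussianReal {u : ℝ → ℝ} (hu : Continuous u) {K : ℝ}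
    (hK : ∀ x, |u x| ≤ K) : Integrable (fun x => x * u x) (gaussianReal 0 1) := by
  have h : Integrable (fun x : ℝ => x) (gaussianReal 0 1) :=
    (memLp_id_gaussianReal' 1 (by simp)).integrable le_rfl
  exact h.mul_bdd (c := K) hu.aestronglyMeasurable (ae_of_all _ fun x => by simpa using hK x)

/-- Gaussian integration by parts in one dimension. -/
lemma integral_id_mul_gaussianReal {u u' : ℝ → ℝ} (hu : ∀ x, HasDerivAt u (u' x) x)
    (hu' : Continuous u') {K : ℝ} (hK : ∀ x, |u x| ≤ K) (hK' : ∀ x, |u' x| ≤ K) :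
    ∫ x, x * u x ∂gaussianReal 0 1 = ∫ x, u' x ∂gaussianReal 0 1 := by
  have hc : Continuous u := continuous_iff_continuousAt.2 fun x => (hu x).continuousAt
  have key (v : ℝ → ℝ) : Integrable v (gaussianReal 0 1) ↔
      Integrable (fun x => v x * gaussianPDFReal 0 1 x) := by
    rw [gaussianReal_of_var_ne_zero _ one_ne_zero,
      integrable_withDensity_iff (measurable_gaussianPDF _ _)
        (ae_of_all _ fun x => gaussianPDF_lt_top)]
    simp only [toReal_gaussianPDF]
  have i1 := (key _).1 (integrable_id_mul_bounded_gaussianReal hc hK)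
  have i2 := (key _).1 (integrable_bounded_gaussianReal hu' hK')
  have i3 := (key _).1 (integrable_bounded_gaussianReal hc hK)
  have := integral_mul_deriv_eq_deriv_mul_of_integrable (u := u) (u' := u')
    (v := gaussianPDFReal 0 1) (v' := fun x => -(x * gaussianPDFReal 0 1 x))
    (fun x _ => hu x) (fun x _ => hasDerivAt_gaussianPDFReal x)
    (i1.neg.congr (ae_of_all _ fun x => by simp; ring)) i2 i3
  rw [integral_gaussianReal_eq_integral_smul one_ne_zero,
    integral_gaussianReal_eq_integral_smul one_ne_zero]
  simp only [smul_eq_mul]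
  rw [← neg_eq_iff_eq_neg, ← integral_neg] at this
  refine Eq.trans (integral_congr_ae (ae_of_all _ fun x => ?_)) (this.trans
    (integral_congr_ae (ae_of_all _ fun x => ?_)))
  · simp only; ring
  · simp only; ring

lemma integrable_coord {κ : Type*} [Fintype κ] (a : κ) :
    Integrable (fun w => w a) (stdGaussianPi κ) := by
  have h : Integrable (fun x : ℝ => x) (gaussianReal 0 1) :=
    (memLp_id_gaussianReal' 1 (by simp)).integrable le_rfl
  exact (measurePreserving_eval (fun _ : κ => gaussianReal 0 1) a).integrable_comp_of_integrable h

variable {κ : Type*} [Fintype κ] [DecidableEq κ]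

/-- Resampling one coordinate preserves a product measure. -/
lemma measurePreserving_update (μ : κ → Measure ℝ) [∀ i, IsProbabilityMeasure (μ i)] (a : κ) :
    MeasurePreserving (fun z : (κ → ℝ) × ℝ => Function.update z.1 a z.2)
      ((Measure.pi μ).prod (μ a)) (Measure.pi μ) := by
  have hm : Measurable (fun z : (κ → ℝ) × ℝ => Function.update z.1 a z.2) :=
    measurable_update'
  refine ⟨hm, (Measure.pi_eq fun s hs => ?_).symm⟩
  rw [Measure.map_apply hm (MeasurableSet.univ_pi hs)]
  -- The preimage of a box is a product: coordinate `a` of the old vector is free, and the new value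
  -- carries its constraint.
  have : (fun z : (κ → ℝ) × ℝ => Function.update z.1 a z.2) ⁻¹' Set.univ.pi s =
      (Set.univ.pi (Function.update s a Set.univ)) ×ˢ s a := by
    ext z
    simp only [Set.mem_preimage, Set.mem_univ_pi, Set.mem_prod]
    constructor
    · intro h
      refine ⟨fun i => ?_, by simpa using h a⟩
      by_cases hi : i = a
      · subst hi; simp
      · simpa [hi] using h i
    · rintro ⟨h, h'⟩ i
      by_cases hi : i = a
      · subst hi; simpa using h'
      · simpa [hi] using h i
  rw [this, Measure.prod_prod, Measure.pi_pi,
    ← Finset.prod_erase_mul _ _ (Finset.mem_univ a),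
    ← Finset.prod_erase_mul _ (fun i => μ i (s i)) (Finset.mem_univ a)]
  simp only [Function.update_self, measure_univ, mul_one]
  congr 1
  refine Finset.prod_congr rfl fun i hi => ?_
  rw [Function.update_of_ne (Finset.ne_of_mem_erase hi)]

/-- Fubini in a single coordinate, without splitting the index type; it reduces integration by parts
to dimension one. -/
lemma integral_pi_eq_integral_update (μ : κ → Measure ℝ) [∀ i, IsProbabilityMeasure (μ i)]
    (a : κ) {v : (κ → ℝ) → ℝ} (hv : Integrable v (Measure.pi μ)) :
    ∫ w, v w ∂Measure.pi μ = ∫ w, ∫ t, v (Function.update w a t) ∂μ a ∂Measure.pi μ := by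
  have mp := measurePreserving_update μ a
  calc ∫ w, v w ∂Measure.pi μ
      = ∫ w, v w ∂(((Measure.pi μ).prod (μ a)).map fun z => Function.update z.1 a z.2) := by
        rw [mp.map_eq]
    _ = ∫ z, v (Function.update z.1 a z.2) ∂((Measure.pi μ).prod (μ a)) :=
        integral_map mp.aemeasurable (by rw [mp.map_eq]; exact hv.1)
    _ = _ := integral_prod _ (mp.integrable_comp_of_integrable hv)

/-- Continuously differentiable functions which are bounded together with their derivative. -/
def BoundedC1 {E : Type*} [NormedAddCommGroup E] [NormedSpace ℝ E] (u : E → ℝ) : Prop :=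
  ContDiff ℝ 1 u ∧ ∃ K, ∀ x, |u x| ≤ K ∧ ‖fderiv ℝ u x‖ ≤ K

/-- Gaussian integration by parts for a standard Gaussian vector. -/
lemma integral_coord_mul {u : (κ → ℝ) → ℝ} (hu : BoundedC1 u) (a : κ) :
    ∫ w, w a * u w ∂stdGaussianPi κ =
      ∫ w, fderiv ℝ u w (Pi.single a 1) ∂stdGaussianPi κ := by
  obtain ⟨hc, K, hK⟩ := hu
  have hcont : Continuous u := hc.continuous
  have hfc : Continuous fun w => fderiv ℝ u w (Pi.single a 1) :=
    (hc.continuous_fderiv one_ne_zero).clm_apply continuous_const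
  have hbd (w) : |fderiv ℝ u w (Pi.single a 1)| ≤ K := by
    have := (fderiv ℝ u w).le_opNorm (Pi.single a 1)
    have h1 : ‖(Pi.single a 1 : κ → ℝ)‖ = 1 := by rw [Pi.norm_single, norm_one]
    rw [h1, mul_one] at this
    exact this.trans (hK w).2
  have i1 : Integrable (fun w => w a * u w) (stdGaussianPi κ) :=
    (integrable_coord a).mul_bdd (c := K) hcont.aestronglyMeasurable
      (ae_of_all _ fun x => by simpa using (hK x).1)
  have i2 : Integrable (fun w => fderiv ℝ u w (Pi.single a 1)) (stdGaussianPi κ) :=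
    Integrable.of_bound hfc.aestronglyMeasurable K (ae_of_all _ fun x => by simpa using hbd x)
  rw [integral_pi_eq_integral_update _ a i1, integral_pi_eq_integral_update _ a i2]
  congr 1
  funext w
  simp only [Function.update_self]
  have hd (t : ℝ) : HasDerivAt (fun t => Function.update w a t) (Pi.single a 1) t :=
    hasDerivAt_update w a t
  have hupd : Continuous fun t : ℝ => Function.update w a t :=
    continuous_const.update a continuous_id
  refine integral_id_mul_gaussianReal (K := K) (u := fun t => u (Function.update w a t))
    (fun t => ?_) (hfc.comp hupd) (fun t => (hK _).1) (fun t => hbd _)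
  exact ((hc.differentiable one_ne_zero _).hasFDerivAt).comp_hasDerivAt t (hd t)

end Stein

/-! ### Closure properties of bounded test functions with bounded derivative. -/

section BoundedC1

variable {E E' : Type*} [NormedAddCommGroup E] [NormedSpace ℝ E] [NormedAddCommGroup E']
  [NormedSpace ℝ E']

namespace BoundedC1

lemma comp_clm {u : E' → ℝ} (hu : BoundedC1 u) (L : E →L[ℝ] E') :
    BoundedC1 (fun x => u (L x)) := by
  obtain ⟨hc, K, hK⟩ := hu
  refine ⟨hc.comp L.contDiff, max K (K * ‖L‖), fun x => ⟨(hK _).1.trans (le_max_left _ _), ?_⟩⟩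
  have h : HasFDerivAt (fun x => u (L x)) ((fderiv ℝ u (L x)).comp L) x :=
    (hc.differentiable one_ne_zero _).hasFDerivAt.comp x L.hasFDerivAt
  rw [h.fderiv]
  refine ((ContinuousLinearMap.opNorm_comp_le _ _).trans ?_).trans (le_max_right _ _)
  gcongr
  exact (hK _).2

lemma const (c : ℝ) : BoundedC1 (fun _ : E => c) :=
  ⟨contDiff_const, |c|, fun x => ⟨le_rfl, by simp⟩⟩

lemma sub {u v : E → ℝ} (hu : BoundedC1 u) (hv : BoundedC1 v) :
    BoundedC1 (fun x => u x - v x) := by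
  obtain ⟨hc, K, hK⟩ := hu
  obtain ⟨hc', K', hK'⟩ := hv
  refine ⟨hc.sub hc', K + K', fun x =>
    ⟨(abs_sub _ _).trans (add_le_add (hK x).1 (hK' x).1), ?_⟩⟩
  rw [fderiv_fun_sub (hc.differentiable one_ne_zero _) (hc'.differentiable one_ne_zero _)]
  exact (norm_sub_le _ _).trans (add_le_add (hK x).2 (hK' x).2)

lemma mul {u v : E → ℝ} (hu : BoundedC1 u) (hv : BoundedC1 v) :
    BoundedC1 (fun x => u x * v x) := by
  obtain ⟨hc, K, hK⟩ := hu
  obtain ⟨hc', K', hK'⟩ := hv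
  have hKn (x) : 0 ≤ K := (abs_nonneg _).trans (hK x).1
  have hKn' (x) : 0 ≤ K' := (abs_nonneg _).trans (hK' x).1
  refine ⟨hc.mul hc', 2 * (K * K'), fun x => ⟨?_, ?_⟩⟩
  · rw [abs_mul]
    have := mul_le_mul (hK x).1 (hK' x).1 (abs_nonneg _) (hKn x)
    nlinarith [mul_nonneg (hKn x) (hKn' x)]
  · rw [fderiv_fun_mul (hc.differentiable one_ne_zero _) (hc'.differentiable one_ne_zero _)]
    refine (norm_add_le _ _).trans ?_
    rw [norm_smul, norm_smul, two_mul]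
    refine add_le_add ?_ ?_
    · exact mul_le_mul (hK x).1 (hK' x).2 (norm_nonneg _) (hKn x)
    · rw [mul_comm K]
      exact mul_le_mul (hK' x).1 (hK x).2 (norm_nonneg _) (hKn' x)

lemma prod {ι : Type*} (s : Finset ι) {u : ι → E → ℝ} (hu : ∀ i ∈ s, BoundedC1 (u i)) :
    BoundedC1 (fun x => ∏ i ∈ s, u i x) := by
  classical
  induction s using Finset.induction_on with
  | empty => simpa using const 1
  | insert i s hi ih =>
    simp only [Finset.prod_insert hi]
    exact (hu i (Finset.mem_insert_self _ _)).mul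
      (ih fun j hj => hu j (Finset.mem_insert_of_mem hj))

lemma integrable [MeasurableSpace E] [OpensMeasurableSpace E] {u : E → ℝ} (hu : BoundedC1 u)
    {Ω : Type*} [MeasurableSpace Ω] {μ : Measure Ω} [IsFiniteMeasure μ] {X : Ω → E}
    (hX : Measurable X) : Integrable (fun w => u (X w)) μ := by
  obtain ⟨hc, K, hK⟩ := hu
  exact Integrable.of_bound (hc.continuous.measurable.comp hX).aestronglyMeasurable K
    (ae_of_all _ fun x => by simpa using (hK _).1)

end BoundedC1

end BoundedC1

/-! ### Gaussian interpolation. -/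

section Interpolation

/-- Matrix-vector multiplication as a continuous linear map. -/
noncomputable def mulVecCLM {κ P : Type*} [Fintype κ] (M : Matrix P κ ℝ) :
    (κ → ℝ) →L[ℝ] (P → ℝ) :=
  LinearMap.toContinuousLinearMap (Matrix.mulVecLin M)

lemma mulVecCLM_apply {κ P : Type*} [Fintype κ] (M : Matrix P κ ℝ) (w : κ → ℝ) :
    mulVecCLM M w = M *ᵥ w := rfl

variable {κ P : Type*} [Fintype κ] [DecidableEq κ] [Fintype P] [DecidableEq P]

lemma fderiv_eq_sum {u : (P → ℝ) → ℝ} (z v : P → ℝ) :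
    fderiv ℝ u z v = ∑ p, v p * fderiv ℝ u z (Pi.single p 1) := by
  conv_lhs => rw [← Finset.univ_sum_single v]
  rw [map_sum]
  refine Finset.sum_congr rfl fun p _ => ?_
  have : (Pi.single p (v p) : P → ℝ) = v p • Pi.single p (1 : ℝ) := by
    rw [← Pi.single_smul, smul_eq_mul, mul_one]
  rw [this, map_smul, smul_eq_mul]

/-- Integration by parts for linear images of a standard Gaussian vector. -/
lemma integral_coord_mul_comp_mulVec {u : (P → ℝ) → ℝ} (hu : BoundedC1 u) (L : Matrix P κ ℝ)
    (a : κ) :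
    ∫ w, w a * u (L *ᵥ w) ∂stdGaussianPi κ =
      ∑ q, L q a * ∫ w, fderiv ℝ u (L *ᵥ w) (Pi.single q 1) ∂stdGaussianPi κ := by
  have h := integral_coord_mul (hu.comp_clm (mulVecCLM L)) a
  simp only [mulVecCLM_apply] at h
  obtain ⟨hc, K, hK⟩ := hu
  have hL : Continuous fun w : κ → ℝ => L *ᵥ w := (mulVecCLM L).continuous
  have hint (q) : Integrable (fun w => fderiv ℝ u (L *ᵥ w) (Pi.single q 1)) (stdGaussianPi κ) := by
    have hfc : Continuous fun w => fderiv ℝ u (L *ᵥ w) (Pi.single q 1) :=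
      ((hc.continuous_fderiv one_ne_zero).comp hL).clm_apply continuous_const
    refine Integrable.of_bound hfc.aestronglyMeasurable K (ae_of_all _ fun w => ?_)
    have := (fderiv ℝ u (L *ᵥ w)).le_opNorm (Pi.single q 1)
    rw [Pi.norm_single, norm_one, mul_one] at this
    exact this.trans (hK _).2
  rw [h]
  simp only [← integral_const_mul]
  rw [← integral_finsetSum _ fun q _ => (hint q).const_mul _]
  congr 1
  funext w
  have hd : HasFDerivAt (fun w => u (L *ᵥ w)) ((fderiv ℝ u (L *ᵥ w)).comp (mulVecCLM L)) w :=
    HasFDerivAt.comp (g := u) w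
      (hc.differentiable one_ne_zero _).hasFDerivAt (mulVecCLM L).hasFDerivAt
  rw [hd.fderiv, ContinuousLinearMap.comp_apply, mulVecCLM_apply, fderiv_eq_sum]
  refine Finset.sum_congr rfl fun q _ => ?_
  simp

/-- Gaussian comparison by interpolation: if the difference of the covariances pairs nonnegatively
with the second derivatives of `F`, then the expectation of `F` increases. -/
theorem integral_mulVec_le_integral_mulVec {F : (P → ℝ) → ℝ} {F₁ : P → (P → ℝ) → ℝ}
    (hF : BoundedC1 F) (hF₁ : ∀ p, BoundedC1 (F₁ p))
    (hd : ∀ p z, fderiv ℝ F z (Pi.single p 1) = F₁ p z)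
    {M N : Matrix P κ ℝ} (hMN : M * Nᵀ = 0)
    (hsign : ∀ p q z, 0 ≤ ((M * Mᵀ) p q - (N * Nᵀ) p q) * fderiv ℝ (F₁ p) z (Pi.single q 1)) :
    ∫ w, F (N *ᵥ w) ∂stdGaussianPi κ ≤ ∫ w, F (M *ᵥ w) ∂stdGaussianPi κ := by
  have hNM : N * Mᵀ = 0 := by
    have := congrArg Matrix.transpose hMN
    simpa using this
  -- A rotation from `N` at `θ = 0` to `M` at `θ = π / 2`. Both act on the same Gaussian vector; `M
  -- * Nᵀ = 0` makes the two images uncorrelated, so no independent copy is needed and the cross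
  -- terms of `L' θ * (L θ)ᵀ` vanish.
  let L : ℝ → Matrix P κ ℝ := fun θ => Real.sin θ • M + Real.cos θ • N
  let L' : ℝ → Matrix P κ ℝ := fun θ => Real.cos θ • M - Real.sin θ • N
  have hLL (θ) : L' θ * (L θ)ᵀ = (Real.sin θ * Real.cos θ) • (M * Mᵀ - N * Nᵀ) := by
    simp only [L, L', Matrix.transpose_add, Matrix.transpose_smul, Matrix.sub_mul, Matrix.mul_add,
      Matrix.smul_mul, Matrix.mul_smul, hMN, hNM, smul_zero, smul_smul, smul_sub]
    rw [mul_comm (Real.cos θ)]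
    simp [sub_eq_add_neg]
  have hmeas (θ) : Measurable fun w : κ → ℝ => L θ *ᵥ w := (mulVecCLM (L θ)).continuous.measurable
  choose hc₁ K hK using hF₁
  have hL' (θ) (p : P) (a : κ) : |L' θ p a| ≤ |M p a| + |N p a| := by
    simp only [L', Matrix.sub_apply, Matrix.smul_apply, smul_eq_mul]
    refine (abs_sub _ _).trans ?_
    rw [abs_mul, abs_mul]
    have h1 := Real.abs_cos_le_one θ
    have h2 := Real.abs_sin_le_one θ
    have := mul_le_mul_of_nonneg_right h1 (abs_nonneg (M p a))
    have := mul_le_mul_of_nonneg_right h2 (abs_nonneg (N p a))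
    linarith
  let G : ℝ → (κ → ℝ) → ℝ := fun θ w => ∑ p, ∑ a, L' θ p a * (w a * F₁ p (L θ *ᵥ w))
  have hG (θ w) : HasDerivAt (fun θ => F (L θ *ᵥ w)) (G θ w) θ := by
    have h1 : HasDerivAt (fun θ => L θ *ᵥ w) (L' θ *ᵥ w) θ := by
      have := ((Real.hasDerivAt_sin θ).smul_const (M *ᵥ w)).add
        ((Real.hasDerivAt_cos θ).smul_const (N *ᵥ w))
      convert! this using 1
      · funext θ
        simp [L, Matrix.add_mulVec, Matrix.smul_mulVec]
      · simp only [L', Matrix.sub_mulVec, Matrix.smul_mulVec, neg_smul]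
        rw [sub_eq_add_neg]
    have h2 := (hF.1.differentiable one_ne_zero (L θ *ᵥ w)).hasFDerivAt.comp_hasDerivAt θ h1
    convert! h2 using 1
    rw [fderiv_eq_sum]
    refine Finset.sum_congr rfl fun p _ => ?_
    rw [hd, Matrix.mulVec, dotProduct, Finset.sum_mul]
    exact Finset.sum_congr rfl fun a _ => by ring
  have hint (θ p a) : Integrable (fun w => w a * F₁ p (L θ *ᵥ w)) (stdGaussianPi κ) :=
    (integrable_coord a).mul_bdd (c := K p)
      ((hc₁ p).continuous.measurable.comp (hmeas θ)).aestronglyMeasurable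
      (ae_of_all _ fun x => by simpa using (hK p _).1)
  have hφ (θ) : HasDerivAt (fun θ => ∫ w, F (L θ *ᵥ w) ∂stdGaussianPi κ)
      (∫ w, G θ w ∂stdGaussianPi κ) θ := by
    refine (hasDerivAt_integral_of_dominated_loc_of_deriv_le (s := Set.univ)
      (F := fun θ w => F (L θ *ᵥ w)) (F' := G)
      (bound := fun w => ∑ p, ∑ a, (|M p a| + |N p a|) * (|w a| * K p)) univ_mem
      (Eventually.of_forall fun θ => (hF.integrable (hmeas θ)).1) (hF.integrable (hmeas θ)) ?_ ?_ ?_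
      (ae_of_all _ fun w θ _ => hG θ w)).2
    · exact (integrable_finsetSum _ fun p _ => integrable_finsetSum _ fun a _ =>
        (hint θ p a).const_mul _).1
    · refine ae_of_all _ fun w θ _ => ?_
      refine (norm_sum_le _ _).trans (Finset.sum_le_sum fun p _ => (norm_sum_le _ _).trans
        (Finset.sum_le_sum fun a _ => ?_))
      rw [norm_mul, norm_mul]
      exact mul_le_mul (hL' θ p a) (mul_le_mul_of_nonneg_left (hK p _).1 (abs_nonneg _))
        (by positivity) (by positivity)
    · exact integrable_finsetSum _ fun p _ => integrable_finsetSum _ fun a _ =>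
        ((integrable_coord a).abs.mul_const _).const_mul _
  have hGval (θ) : ∫ w, G θ w ∂stdGaussianPi κ = (Real.sin θ * Real.cos θ) * ∑ p, ∑ q,
      ∫ w, ((M * Mᵀ) p q - (N * Nᵀ) p q) * fderiv ℝ (F₁ p) (L θ *ᵥ w) (Pi.single q 1)
        ∂stdGaussianPi κ := by
    simp only [G]
    have hint' (p) : Integrable (fun w => ∑ a, L' θ p a * (w a * F₁ p (L θ *ᵥ w)))
        (stdGaussianPi κ) := integrable_finsetSum _ fun a _ => (hint θ p a).const_mul (L' θ p a)
    rw [integral_finsetSum _ fun p _ => hint' p, Finset.mul_sum]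
    refine Finset.sum_congr rfl fun p _ => ?_
    rw [integral_finsetSum _ fun a _ => (hint θ p a).const_mul (L' θ p a)]
    simp only [integral_const_mul]
    -- Integration by parts in each `w a` produces `L' θ p a * L θ q a`; summed over `a`, this is an
    -- entry of `L' θ * (L θ)ᵀ`, a multiple of the covariance difference.
    simp only [integral_coord_mul_comp_mulVec ⟨hc₁ p, K p, hK p⟩, Finset.mul_sum]
    rw [Finset.sum_comm]
    refine Finset.sum_congr rfl fun q _ => ?_
    have := congrFun (congrFun (hLL θ) p) q
    simp only [Matrix.mul_apply, Matrix.smul_apply, Matrix.sub_apply, smul_eq_mul,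
      Matrix.transpose_apply] at this
    simp only [← mul_assoc, ← Finset.sum_mul, this, Matrix.mul_apply, Matrix.transpose_apply]
  have hmono : MonotoneOn (fun θ => ∫ w, F (L θ *ᵥ w) ∂stdGaussianPi κ)
      (Set.Icc 0 (Real.pi / 2)) := by
    refine monotoneOn_of_hasDerivWithinAt_nonneg (convex_Icc _ _)
      (fun θ _ => (hφ θ).continuousAt.continuousWithinAt)
      (fun θ _ => (hφ θ).hasDerivWithinAt) fun θ hθ => ?_
    rw [interior_Icc] at hθ
    rw [hGval]
    refine mul_nonneg (mul_nonneg ?_ ?_) (Finset.sum_nonneg fun p _ => Finset.sum_nonneg fun q _ =>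
      integral_nonneg fun w => hsign p q _)
    · exact Real.sin_nonneg_of_nonneg_of_le_pi hθ.1.le (by linarith [hθ.2, Real.pi_pos])
    · exact Real.cos_nonneg_of_neg_pi_div_two_le_of_le (by linarith [hθ.1, Real.pi_pos]) hθ.2.le
  have hpi : (0 : ℝ) ≤ Real.pi / 2 := by positivity
  have := hmono (Set.left_mem_Icc.2 hpi) (Set.right_mem_Icc.2 hpi) hpi
  simpa [L] using this

end Interpolation

/-! ### A smooth step function. -/

section SmoothStep

lemma deriv_smoothTransition_eq_zero {x : ℝ} (hx : x ∉ Set.Icc (0 : ℝ) 1) :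
    deriv Real.smoothTransition x = 0 := by
  rcases not_and_or.1 hx with h | h
  · have : Real.smoothTransition =ᶠ[𝓝 x] fun _ => 0 := by
      filter_upwards [gt_mem_nhds (not_le.1 h)] with y hy
      exact Real.smoothTransition.zero_of_nonpos hy.le
    rw [this.deriv_eq, deriv_const]
  · have : Real.smoothTransition =ᶠ[𝓝 x] fun _ => 1 := by
      filter_upwards [lt_mem_nhds (not_le.1 h)] with y hy
      exact Real.smoothTransition.one_of_one_le hy.le
    rw [this.deriv_eq, deriv_const]

lemma contDiff_deriv_smoothTransition : ContDiff ℝ 1 (deriv Real.smoothTransition) := by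
  have h : ContDiff ℝ (2 : ℕ∞) Real.smoothTransition := Real.smoothTransition.contDiff
  exact (contDiff_succ_iff_deriv (n := 1).1 h).2.2

/-- The derivative is supported in `[0, 1]`, and continuous functions with compact support are
bounded. -/
lemma boundedC1_deriv_smoothTransition : BoundedC1 (deriv Real.smoothTransition) := by
  have hc : HasCompactSupport (deriv Real.smoothTransition) :=
    HasCompactSupport.intro isCompact_Icc fun x hx => deriv_smoothTransition_eq_zero hx
  have hs := contDiff_deriv_smoothTransition
  obtain ⟨C, hC⟩ := hc.exists_bound_of_continuous hs.continuous
  obtain ⟨C', hC'⟩ := (hc.fderiv (𝕜 := ℝ)).exists_bound_of_continuous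
    (hs.continuous_fderiv one_ne_zero)
  exact ⟨hs, max C C', fun x => ⟨(hC x).trans (le_max_left _ _), (hC' x).trans (le_max_right _ _)⟩⟩

lemma boundedC1_smoothTransition : BoundedC1 Real.smoothTransition := by
  obtain ⟨-, C, hC⟩ := boundedC1_deriv_smoothTransition
  have hs : ContDiff ℝ (1 : ℕ∞) Real.smoothTransition := Real.smoothTransition.contDiff
  refine ⟨hs, max 1 C, fun x => ⟨?_, ?_⟩⟩
  · rw [abs_of_nonneg (Real.smoothTransition.nonneg x)]
    exact (Real.smoothTransition.le_one x).trans (le_max_left _ _)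
  · rw [← norm_deriv_eq_norm_fderiv]
    exact (hC x).1.trans (le_max_right _ _)

lemma BoundedC1.comp_add_const {E : Type*} [NormedAddCommGroup E] [NormedSpace ℝ E] {u : E → ℝ}
    (hu : BoundedC1 u) (c : E) : BoundedC1 (fun x => u (x + c)) := by
  obtain ⟨hc, K, hK⟩ := hu
  refine ⟨hc.comp (contDiff_id.add contDiff_const), K, fun x => ⟨(hK _).1, ?_⟩⟩
  rw [fderiv_comp_add_right]
  exact (hK _).2

end SmoothStep

/-! ### Gordon's comparison inequality. -/

section Blocks

variable {I J : Type*} [Fintype I] [Fintype J]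

/-- A smooth version of the indicator of `⋂ i, ⋃ j, {z | z (i, j) ≤ l (i, j)}`. -/
noncomputable def blockFun (ψ : I × J → ℝ → ℝ) (z : I × J → ℝ) : ℝ :=
  ∏ i, (1 - ∏ j, ψ (i, j) (z (i, j)))

lemma BoundedC1.comp_coord {P : Type*} [Fintype P] {u : ℝ → ℝ} (hu : BoundedC1 u) (p : P) :
    BoundedC1 (fun z : P → ℝ => u (z p)) :=
  hu.comp_clm (ContinuousLinearMap.proj (R := ℝ) (φ := fun _ : P => ℝ) p)

lemma boundedC1_blockFun {ψ : I × J → ℝ → ℝ} (hψ : ∀ p, BoundedC1 (ψ p)) :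
    BoundedC1 (blockFun ψ) :=
  BoundedC1.prod _ fun i _ => (BoundedC1.const 1).sub
    (BoundedC1.prod _ fun j _ => (hψ (i, j)).comp_coord (i, j))

variable [DecidableEq I] [DecidableEq J]

/-- The partial derivatives of `blockFun`. -/
noncomputable def blockFunDeriv (ψ ψ' : I × J → ℝ → ℝ) (p : I × J) (z : I × J → ℝ) : ℝ :=
  (0 - ∏ i ∈ Finset.univ.erase p.1, (1 - ∏ j, ψ (i, j) (z (i, j)))) *
    (ψ' p (z p) * ∏ j ∈ Finset.univ.erase p.2, ψ (p.1, j) (z (p.1, j)))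

variable {ψ ψ' : I × J → ℝ → ℝ}

lemma boundedC1_blockFunDeriv (hψ : ∀ p, BoundedC1 (ψ p)) (hψ' : ∀ p, BoundedC1 (ψ' p))
    (p : I × J) : BoundedC1 (blockFunDeriv ψ ψ' p) :=
  ((BoundedC1.const 0).sub (BoundedC1.prod _ fun i _ => (BoundedC1.const 1).sub
    (BoundedC1.prod _ fun j _ => (hψ (i, j)).comp_coord (i, j)))).mul
    (((hψ' p).comp_coord p).mul (BoundedC1.prod _ fun j _ => (hψ (p.1, j)).comp_coord (p.1, j)))

lemma hasDerivAt_comp_update {P : Type*} [Fintype P] [DecidableEq P] {u : (P → ℝ) → ℝ}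
    (hu : BoundedC1 u) (z : P → ℝ) (p : P) :
    HasDerivAt (fun t => u (Function.update z p t)) (fderiv ℝ u z (Pi.single p 1)) (z p) := by
  have h := (hu.1.differentiable one_ne_zero (Function.update z p (z p))).hasFDerivAt.comp_hasDerivAt
    (z p) (hasDerivAt_update z p (z p))
  rw [Function.update_eq_self] at h
  exact h

/-- As a function of one coordinate, `blockFun` is affine in `ψ p t`, so its partial derivatives can
be read off. -/
lemma blockFun_update (z : I × J → ℝ) (p : I × J) (t : ℝ) :
    blockFun ψ (Function.update z p t) =
      (∏ i ∈ Finset.univ.erase p.1, (1 - ∏ j, ψ (i, j) (z (i, j)))) *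
        (1 - (∏ j ∈ Finset.univ.erase p.2, ψ (p.1, j) (z (p.1, j))) * ψ p t) := by
  rw [blockFun, ← Finset.prod_erase_mul _ _ (Finset.mem_univ p.1),
    ← Finset.prod_erase_mul _ _ (Finset.mem_univ p.2)]
  congr 1
  · refine Finset.prod_congr rfl fun i hi => ?_
    congr 1
    refine Finset.prod_congr rfl fun j _ => ?_
    rw [Function.update_of_ne]
    rintro rfl
    simp at hi
  · congr 2
    · refine Finset.prod_congr rfl fun j hj => ?_
      rw [Function.update_of_ne]
      intro h
      rw [← h] at hj
      simp at hj
    · simp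

lemma fderiv_blockFun (hψ : ∀ p, BoundedC1 (ψ p))
    (hd : ∀ p t, HasDerivAt (ψ p) (ψ' p t) t) (p : I × J) (z : I × J → ℝ) :
    fderiv ℝ (blockFun ψ) z (Pi.single p 1) = blockFunDeriv ψ ψ' p z := by
  have h1 := hasDerivAt_comp_update (boundedC1_blockFun hψ) z p
  simp only [blockFun_update] at h1
  have h2 := (((hd p (z p)).const_mul
    (∏ j ∈ Finset.univ.erase p.2, ψ (p.1, j) (z (p.1, j)))).const_sub 1).const_mul
    (∏ i ∈ Finset.univ.erase p.1, (1 - ∏ j, ψ (i, j) (z (i, j))))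
  rw [h1.unique h2, blockFunDeriv]
  ring

/-- Gives the sign of the mixed second derivatives across blocks: raising a coordinate in another
block shrinks a factor `1 - ∏ ψ`, which enters the first derivative with a minus sign. -/
lemma monotone_blockFunDeriv_update (h0 : ∀ p t, 0 ≤ ψ p t) (h1 : ∀ p t, ψ p t ≤ 1)
    (hm : ∀ p, Monotone (ψ p)) (h0' : ∀ p t, 0 ≤ ψ' p t) {p q : I × J} (hpq : p.1 ≠ q.1)
    (z : I × J → ℝ) : Monotone (fun t => blockFunDeriv ψ ψ' p (Function.update z q t)) := by
  intro s t hst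
  have hp : p ≠ q := fun h => hpq (congrArg Prod.fst h)
  have hpj (j) : (p.1, j) ≠ q := fun h => hpq (by rw [← h])
  simp only [blockFunDeriv, Function.update_of_ne hp, Function.update_of_ne (hpj _)]
  refine mul_le_mul_of_nonneg_right ?_
    (mul_nonneg (h0' _ _) (Finset.prod_nonneg fun _ _ => h0 _ _))
  refine sub_le_sub_left (Finset.prod_le_prod (fun i _ => ?_) fun i _ => ?_) _
  · exact sub_nonneg.2 (Finset.prod_le_one (fun _ _ => h0 _ _) fun _ _ => h1 _ _)
  · refine sub_le_sub_left (Finset.prod_le_prod (fun _ _ => h0 _ _) fun j _ => hm _ ?_) _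
    exact update_le_update_iff.2 ⟨hst, fun _ _ => le_rfl⟩ (i, j)

/-- **Gordon's comparison inequality**, with a margin `ε` in the thresholds. -/
theorem measure_exists_forall_le {κ : Type*} [Fintype κ] [DecidableEq κ]
    {M N : Matrix (I × J) κ ℝ} (hMN : M * Nᵀ = 0)
    (hblock : ∀ i j k, (M * Mᵀ) (i, j) (i, k) = (N * Nᵀ) (i, j) (i, k))
    (hcov : ∀ p q, (N * Nᵀ) p q ≤ (M * Mᵀ) p q) (l : I × J → ℝ) {ε : ℝ} (hε : 0 < ε) :
    stdGaussianPi κ {w | ∃ i, ∀ j, l (i, j) + ε < (M *ᵥ w) (i, j)} ≤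
      stdGaussianPi κ {w | ∃ i, ∀ j, l (i, j) < (N *ᵥ w) (i, j)} := by
  let S := Real.smoothTransition
  -- Rises from 0 at `t = l p` to 1 at `t = l p + ε`; this smoothing width is the margin in the
  -- statement.
  let ψ : I × J → ℝ → ℝ := fun p t => S (ε⁻¹ * t + -(ε⁻¹ * l p))
  let ψ' : I × J → ℝ → ℝ := fun p t => ε⁻¹ * deriv S (ε⁻¹ * t + -(ε⁻¹ * l p))
  have hSd (t) : HasDerivAt S (deriv S t) t :=
    (boundedC1_smoothTransition.1.differentiable one_ne_zero t).hasDerivAt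
  have hSmono : Monotone S := Real.smoothTransition.monotone
  have hS0 (t) : 0 ≤ S t := Real.smoothTransition.nonneg t
  have hS1 (t) : S t ≤ 1 := Real.smoothTransition.le_one t
  have hψ (p) : BoundedC1 (ψ p) :=
    (boundedC1_smoothTransition.comp_add_const _).comp_clm (ε⁻¹ • ContinuousLinearMap.id ℝ ℝ)
  have hψ' (p) : BoundedC1 (ψ' p) := (BoundedC1.const _).mul
    ((boundedC1_deriv_smoothTransition.comp_add_const _).comp_clm
      (ε⁻¹ • ContinuousLinearMap.id ℝ ℝ))
  have hd (p t) : HasDerivAt (ψ p) (ψ' p t) t := by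
    have h1 : HasDerivAt (fun t => ε⁻¹ * t + -(ε⁻¹ * l p)) ε⁻¹ t := by
      simpa using ((hasDerivAt_id t).const_mul ε⁻¹).add_const (-(ε⁻¹ * l p))
    have h2 := (hSd (ε⁻¹ * t + -(ε⁻¹ * l p))).comp t h1
    convert! h2 using 1
    simp only [ψ']
    ring
  have hm (p) : Monotone (ψ p) := fun s t hst => hSmono (by gcongr)
  have hderiv_nonneg {u : ℝ → ℝ} (hu : Monotone u) (t : ℝ) : 0 ≤ deriv u t := by
    rw [← derivWithin_univ]
    exact (hu.monotoneOn Set.univ).derivWithin_nonneg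
  have h0' (p t) : 0 ≤ ψ' p t := mul_nonneg (by positivity) (hderiv_nonneg hSmono _)
  have hF := boundedC1_blockFun hψ
  have key := integral_mulVec_le_integral_mulVec hF (boundedC1_blockFunDeriv hψ hψ')
    (fderiv_blockFun hψ hd) hMN (fun p q z => by
      -- Within a block the covariances agree, so the second derivatives there, whose sign is not
      -- controlled, do not matter.
      by_cases hpq : p.1 = q.1
      · have : (M * Mᵀ) p q = (N * Nᵀ) p q := by
          obtain ⟨i, j⟩ := p
          obtain ⟨i', k⟩ := q
          obtain rfl : i = i' := hpq
          exact hblock i j k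
        rw [this, sub_self, zero_mul]
      · refine mul_nonneg (sub_nonneg.2 (hcov p q)) ?_
        have h := hasDerivAt_comp_update (boundedC1_blockFunDeriv hψ hψ' p) z q
        rw [← h.deriv]
        exact hderiv_nonneg (monotone_blockFunDeriv_update (fun _ _ => hS0 _) (fun _ _ => hS1 _)
          hm h0' hpq z) _)
  have hmeas (L : Matrix (I × J) κ ℝ) : Continuous fun w : κ → ℝ => L *ᵥ w :=
    (mulVecCLM L).continuous
  have hset (L : Matrix (I × J) κ ℝ) (c : I × J → ℝ) :
      MeasurableSet {w | ∃ i, ∀ j, c (i, j) < (L *ᵥ w) (i, j)} := by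
    simp only [Set.ofPred_exists, Set.ofPred_forall]
    exact MeasurableSet.iUnion fun i => MeasurableSet.iInter fun j =>
      measurableSet_lt measurable_const ((measurable_pi_apply _).comp (hmeas L).measurable)
  have hle (z : I × J → ℝ) : blockFun ψ z ≤ 1 :=
    Finset.prod_le_one (fun i _ => sub_nonneg.2
      (Finset.prod_le_one (fun _ _ => hS0 _) fun _ _ => hS1 _))
      fun i _ => sub_le_self _ (Finset.prod_nonneg fun _ _ => hS0 _)
  have hnn (z : I × J → ℝ) : 0 ≤ blockFun ψ z :=
    Finset.prod_nonneg fun i _ => sub_nonneg.2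
      (Finset.prod_le_one (fun _ _ => hS0 _) fun _ _ => hS1 _)
  have hint (L : Matrix (I × J) κ ℝ) :
      Integrable (fun w => blockFun ψ (L *ᵥ w)) (stdGaussianPi κ) :=
    hF.integrable (hmeas L).measurable
  have hone (L : Matrix (I × J) κ ℝ) : ∫ w, (1 - blockFun ψ (L *ᵥ w)) ∂stdGaussianPi κ =
      1 - ∫ w, blockFun ψ (L *ᵥ w) ∂stdGaussianPi κ := by
    rw [integral_sub (integrable_const _) (hint L)]
    simp
  have upper : (stdGaussianPi κ).real {w | ∃ i, ∀ j, l (i, j) + ε < (M *ᵥ w) (i, j)} ≤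
      ∫ w, (1 - blockFun ψ (M *ᵥ w)) ∂stdGaussianPi κ := by
    rw [← integral_indicator_one (hset M fun p => l p + ε)]
    refine integral_mono ((integrable_const (1 : ℝ)).indicator (hset M fun p => l p + ε))
      ((integrable_const _).sub (hint M)) fun w => ?_
    refine Set.indicator_le' (fun w hw => ?_) (fun w _ => sub_nonneg.2 (hle _)) w
    obtain ⟨i, hi⟩ := hw
    have : blockFun ψ (M *ᵥ w) = 0 := by
      refine Finset.prod_eq_zero (Finset.mem_univ i) ?_
      rw [Finset.prod_eq_one, sub_self]
      intro j _
      refine Real.smoothTransition.one_of_one_le ?_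
      have h1 : ε⁻¹ * ε = 1 := inv_mul_cancel₀ hε.ne'
      have h2 := mul_le_mul_of_nonneg_left (hi j).le (inv_nonneg.2 hε.le)
      linarith
    simp [this]
  have lower : ∫ w, (1 - blockFun ψ (N *ᵥ w)) ∂stdGaussianPi κ ≤
      (stdGaussianPi κ).real {w | ∃ i, ∀ j, l (i, j) < (N *ᵥ w) (i, j)} := by
    rw [← integral_indicator_one (hset N l)]
    refine integral_mono ((integrable_const _).sub (hint N))
      ((integrable_const (1 : ℝ)).indicator (hset N l)) fun w => ?_
    by_cases hw : w ∈ {w | ∃ i, ∀ j, l (i, j) < (N *ᵥ w) (i, j)}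
    · rw [Set.indicator_of_mem hw]
      simpa using hnn _
    · rw [Set.indicator_of_notMem hw]
      simp only [Set.mem_ofPred_eq, not_exists, not_forall, not_lt] at hw
      have : blockFun ψ (N *ᵥ w) = 1 := by
        refine Finset.prod_eq_one fun i _ => ?_
        obtain ⟨j, hj⟩ := hw i
        rw [Finset.prod_eq_zero (Finset.mem_univ j), sub_zero]
        refine Real.smoothTransition.zero_of_nonpos ?_
        have h2 := mul_le_mul_of_nonneg_left hj (inv_nonneg.2 hε.le)
        linarith
      simp [this]
  rw [hone] at upper lower
  exact (ENNReal.toReal_le_toReal (measure_ne_top _ _) (measure_ne_top _ _)).1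
    (upper.trans ((sub_le_sub_left key 1).trans lower))

end Blocks

/-! ### Gaussian marginals of the common probability space. -/

section Marginals

/-- Selecting distinct coordinates maps a standard Gaussian vector to a standard Gaussian vector. -/
lemma measurePreserving_comp_injective {ι κ : Type*} [Fintype ι] [Fintype κ] {e : ι → κ}
    (he : Function.Injective e) :
    MeasurePreserving (fun (w : κ → ℝ) i => w (e i)) (stdGaussianPi κ) (stdGaussianPi ι) := by
  have hm : Measurable fun (w : κ → ℝ) (i : ι) => w (e i) :=
    measurable_pi_lambda _ fun i => measurable_pi_apply _
  refine ⟨hm, ?_⟩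
  have h : iIndepFun (fun (k : κ) (w : κ → ℝ) => w k) (stdGaussianPi κ) :=
    iIndepFun_pi (X := fun _ x => x) fun _ => aemeasurable_id
  have h2 := (iIndepFun_iff_map_fun_eq_pi_map
    (fun i => (measurable_pi_apply (e i)).aemeasurable)).1 (h.precomp he)
  rw [h2]
  congr 1
  funext i
  exact (measurePreserving_eval (fun _ : κ => gaussianReal 0 1) (e i)).map_eq

lemma measurePreserving_curry_gaussian (m n : ℕ) :
    MeasurePreserving (fun (w : Fin m × Fin n → ℝ) i j => w (i, j))
      (stdGaussianPi (Fin m × Fin n)) (gaussianMatrix m n) := by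
  have hu : Measurable fun (A : Fin m → Fin n → ℝ) (p : Fin m × Fin n) => A p.1 p.2 :=
    measurable_pi_lambda _ fun p => (measurable_pi_apply p.2).comp (measurable_pi_apply p.1)
  have hc : Measurable fun (w : Fin m × Fin n → ℝ) i j => w (i, j) :=
    measurable_pi_lambda _ fun i => measurable_pi_lambda _ fun j => measurable_pi_apply _
  have h : (gaussianMatrix m n).map (fun A p => A p.1 p.2) = stdGaussianPi (Fin m × Fin n) := by
    refine (Measure.pi_eq fun s hs => ?_).symm
    rw [Measure.map_apply hu (MeasurableSet.univ_pi hs)]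
    have : (fun (A : Fin m → Fin n → ℝ) (p : Fin m × Fin n) => A p.1 p.2) ⁻¹' Set.univ.pi s =
        Set.univ.pi fun i => Set.univ.pi fun j => s (i, j) := by
      ext A
      simp [Set.mem_pi]
    rw [this, gaussianMatrix, Measure.pi_pi, Fintype.prod_prod_type]
    exact Finset.prod_congr rfl fun i _ => Measure.pi_pi _ _
  refine ⟨hc, ?_⟩
  rw [← h, Measure.map_map hc hu]
  exact Measure.map_id

/-- The coordinates of a Gaussian vector indexed by `Option (Fin m₁ ⊕ Fin m₂) × Option (Fin n)` which
do not lie in the extra row or column form a Gaussian pair, independent of the corner coordinate. -/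
lemma measurePreserving_pair_corner (m₁ m₂ n : ℕ) :
    MeasurePreserving (fun w : Option (Fin m₁ ⊕ Fin m₂) × Option (Fin n) → ℝ =>
        (((fun i j => w (some (Sum.inl i), some j), fun i j => w (some (Sum.inr i), some j)) :
          (Fin m₁ → Fin n → ℝ) × (Fin m₂ → Fin n → ℝ)), w (none, none)))
      (stdGaussianPi _) ((gaussianPair m₁ m₂ n).prod (gaussianReal 0 1)) := by
  let e : ((Fin m₁ × Fin n) ⊕ (Fin m₂ × Fin n)) ⊕ Unit →
      Option (Fin m₁ ⊕ Fin m₂) × Option (Fin n) :=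
    Sum.elim (Sum.elim (fun p => (some (Sum.inl p.1), some p.2))
      (fun p => (some (Sum.inr p.1), some p.2))) (fun _ => (none, none))
  have he : Function.Injective e := by
    rintro ((⟨a, b⟩ | ⟨a, b⟩) | a) ((⟨c, d⟩ | ⟨c, d⟩) | c) h <;> simp_all [e]
  have h1 := measurePreserving_comp_injective he
  have h2 := measurePreserving_sumPiEquivProdPi
    (fun _ : ((Fin m₁ × Fin n) ⊕ (Fin m₂ × Fin n)) ⊕ Unit => gaussianReal 0 1)
  have h3 := measurePreserving_sumPiEquivProdPi
    (fun _ : (Fin m₁ × Fin n) ⊕ (Fin m₂ × Fin n) => gaussianReal 0 1)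
  have h4 := (measurePreserving_curry_gaussian m₁ n).prod (measurePreserving_curry_gaussian m₂ n)
  have h5 := (h4.comp h3).prod (measurePreserving_eval (fun _ : Unit => gaussianReal 0 1) ())
  exact h5.comp (h2.comp h1)

end Marginals

/-! ### The bilinear and the linear process. -/

section Bilinear

variable {I J R S : Type*} [Fintype I] [Fintype J] [DecidableEq I] [DecidableEq J]
  [Fintype R] [Fintype S] [DecidableEq R] [DecidableEq S]

lemma dotProduct_le_sqrt_mul_sqrt {ι : Type*} [Fintype ι] (x y : ι → ℝ) :
    x ⬝ᵥ y ≤ √(x ⬝ᵥ x) * √(y ⬝ᵥ y) := by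
  have := Real.sum_mul_le_sqrt_mul_sqrt Finset.univ x y
  simpa [dotProduct, pow_two] using this

/-- Gordon's comparison for the bilinear process `yᵀ C x + ‖x‖ ‖y‖ g₀` and the linear process
`‖x‖ hᵀ y - ‖y‖ gᵀ x`. -/
theorem measure_bilinear_le_measure_linear (y : I → R → ℝ) (x : J → S → ℝ) (l : J → ℝ) {ε : ℝ}
    (hε : 0 < ε) :
    stdGaussianPi (Option R × Option S) {w | ∃ i, ∀ j, l j + ε <
        (∑ r, y i r * ∑ s, w (some r, some s) * x j s) +
          √(x j ⬝ᵥ x j) * √(y i ⬝ᵥ y i) * w (none, none)} ≤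
      stdGaussianPi (Option R × Option S) {w | ∃ i, ∀ j, l j <
        √(x j ⬝ᵥ x j) * (∑ r, w (some r, none) * y i r) -
          √(y i ⬝ᵥ y i) * ∑ s, w (none, some s) * x j s} := by
  let nx : J → ℝ := fun j => √(x j ⬝ᵥ x j)
  let ny : I → ℝ := fun i => √(y i ⬝ᵥ y i)
  -- One array of normals carries everything: the main block is `C`, the corner is `g₀`, the extra
  -- column is `h` and the extra row is `g`. The rows of `M` and `N` have disjoint supports, whence
  -- `M * Nᵀ = 0`.
  let M : Matrix (I × J) (Option R × Option S) ℝ := fun p a =>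
    a.1.elim (a.2.elim (nx p.2 * ny p.1) fun _ => 0)
      fun r => a.2.elim 0 fun s => y p.1 r * x p.2 s
  let N : Matrix (I × J) (Option R × Option S) ℝ := fun p a =>
    a.1.elim (a.2.elim 0 fun s => -(ny p.1 * x p.2 s))
      fun r => a.2.elim (nx p.2 * y p.1 r) fun _ => 0
  have hMN : M * Nᵀ = 0 := by
    ext p q
    rw [Matrix.mul_apply]
    simp only [Matrix.transpose_apply]
    simp [M, N, Fintype.sum_prod_type, Fintype.sum_option]
  have hMM (p q) : (M * Mᵀ) p q =
      nx p.2 * ny p.1 * (nx q.2 * ny q.1) + (y p.1 ⬝ᵥ y q.1) * (x p.2 ⬝ᵥ x q.2) := by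
    rw [Matrix.mul_apply]
    simp only [Matrix.transpose_apply]
    simp only [M, Fintype.sum_prod_type, Fintype.sum_option,
      Option.elim, dotProduct, Finset.sum_mul_sum]
    simp only [mul_zero, Finset.sum_const_zero, add_zero, zero_add]
    congr 1
    exact Finset.sum_congr rfl fun r _ => Finset.sum_congr rfl fun s _ => by ring
  have hNN (p q) : (N * Nᵀ) p q =
      nx p.2 * nx q.2 * (y p.1 ⬝ᵥ y q.1) + ny p.1 * ny q.1 * (x p.2 ⬝ᵥ x q.2) := by
    rw [Matrix.mul_apply]
    simp only [Matrix.transpose_apply]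
    simp only [N, Fintype.sum_prod_type, Fintype.sum_option,
      Option.elim, dotProduct, Finset.mul_sum]
    simp only [mul_zero, Finset.sum_const_zero, add_zero, zero_add]
    rw [add_comm]
    congr 1
    · exact Finset.sum_congr rfl fun r _ => by ring
    · exact Finset.sum_congr rfl fun r _ => by ring
  -- The factorisation behind Gordon's hypotheses: both factors are nonnegative by Cauchy–Schwarz,
  -- and the second vanishes for equal `y`.
  have hdiff (p q) : (M * Mᵀ) p q - (N * Nᵀ) p q =
      (nx p.2 * nx q.2 - x p.2 ⬝ᵥ x q.2) * (ny p.1 * ny q.1 - y p.1 ⬝ᵥ y q.1) := by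
    rw [hMM, hNN]; ring
  have key := measure_exists_forall_le (M := M) (N := N) hMN
    (fun i j k => by
      rw [← sub_eq_zero, hdiff]
      simp only [ny]
      have hnn : 0 ≤ y i ⬝ᵥ y i := Finset.sum_nonneg fun r _ => mul_self_nonneg _
      rw [Real.mul_self_sqrt hnn, sub_self, mul_zero])
    (fun p q => by
      rw [← sub_nonneg, hdiff]
      exact mul_nonneg (sub_nonneg.2 (dotProduct_le_sqrt_mul_sqrt _ _))
        (sub_nonneg.2 (dotProduct_le_sqrt_mul_sqrt _ _)))
    (fun p => l p.2) hε
  have hMw (w i j) : (M *ᵥ w) (i, j) = (∑ r, y i r * ∑ s, w (some r, some s) * x j s) +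
      nx j * ny i * w (none, none) := by
    simp only [Matrix.mulVec, dotProduct, M, Fintype.sum_prod_type, Fintype.sum_option, Option.elim]
    simp only [zero_mul, Finset.sum_const_zero, add_zero, zero_add, Finset.mul_sum]
    rw [add_comm]
    congr 1
    exact Finset.sum_congr rfl fun r _ => Finset.sum_congr rfl fun s _ => by ring
  have hNw (w i j) : (N *ᵥ w) (i, j) = nx j * (∑ r, w (some r, none) * y i r) -
      ny i * ∑ s, w (none, some s) * x j s := by
    simp only [Matrix.mulVec, dotProduct, N, Fintype.sum_prod_type, Fintype.sum_option, Option.elim]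
    simp only [zero_mul, Finset.sum_const_zero, add_zero, zero_add, Finset.mul_sum, neg_mul,
      Finset.sum_neg_distrib]
    rw [add_comm, ← sub_eq_add_neg]
    congr 1
    · exact Finset.sum_congr rfl fun r _ => by ring
    · exact Finset.sum_congr rfl fun r _ => by ring
  simpa only [hMw, hNw] using key

end Bilinear

/-! ### Concentration of the projected norm. -/

section Concentration

lemma memLp_sq_gaussianReal : MemLp (fun t : ℝ => t ^ 2) 2 (gaussianReal 0 1) := by
  have h := (memLp_id_gaussianReal' (μ := 0) (v := 1) 4 (by simp))
  refine (memLp_two_iff_integrable_sq (by fun_prop)).2 ?_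
  have := h.integrable_norm_pow (p := 4) (by norm_num)
  refine this.congr (ae_of_all _ fun t => ?_)
  simp only [id, Real.norm_eq_abs]
  rw [← pow_mul, show 2 * 2 = 4 by rfl, ← abs_pow, abs_of_nonneg (by positivity)]

lemma memLp_sq_posPart_gaussianReal :
    MemLp (fun t : ℝ => (max t 0) ^ 2) 2 (gaussianReal 0 1) := by
  refine memLp_sq_gaussianReal.mono (by fun_prop) (ae_of_all _ fun t => ?_)
  rw [Real.norm_eq_abs, Real.norm_eq_abs, abs_of_nonneg (by positivity),
    abs_of_nonneg (by positivity)]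
  rcases le_total t 0 with h | h
  · rw [max_eq_right h]; simpa using sq_nonneg t
  · rw [max_eq_left h]

lemma integral_sq_gaussianReal : ∫ t, t ^ 2 ∂gaussianReal 0 1 = 1 := by
  have h := variance_fun_id_gaussianReal (μ := 0) (v := 1)
  rw [variance_eq_integral (by fun_prop), integral_id_gaussianReal] at h
  simpa using h

lemma integral_sq_posPart_gaussianReal : ∫ t, (max t 0) ^ 2 ∂gaussianReal 0 1 = 1 / 2 := by
  -- By symmetry the positive and negative parts share the second moment 1 equally.
  have h1 : ∫ t, (max (-t) 0) ^ 2 ∂gaussianReal 0 1 = ∫ t, (max t 0) ^ 2 ∂gaussianReal 0 1 := by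
    have h := gaussianReal_map_neg (μ := 0) (v := 1)
    rw [neg_zero] at h
    conv_rhs => rw [← h]
    rw [integral_map (by fun_prop) (by fun_prop)]
  have i1 : Integrable (fun t : ℝ => (max t 0) ^ 2) (gaussianReal 0 1) :=
    memLp_sq_posPart_gaussianReal.integrable (by norm_num)
  have i2 : Integrable (fun t : ℝ => (max (-t) 0) ^ 2) (gaussianReal 0 1) := by
    refine (memLp_sq_gaussianReal.integrable (by norm_num)).mono (by fun_prop)
      (ae_of_all _ fun t => ?_)
    rw [Real.norm_eq_abs, Real.norm_eq_abs, abs_of_nonneg (by positivity),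
      abs_of_nonneg (by positivity)]
    rcases le_total t 0 with h | h
    · rw [max_eq_left (by linarith)]; simp
    · rw [max_eq_right (by linarith)]; simpa using sq_nonneg t
  have h2 := integral_add i1 i2
  have h3 : ∫ t, ((max t 0) ^ 2 + (max (-t) 0) ^ 2) ∂gaussianReal 0 1 = 1 := by
    rw [← integral_sq_gaussianReal]
    congr 1
    funext t
    rcases le_total t 0 with h | h
    · rw [max_eq_right h, max_eq_left (by linarith)]; ring
    · rw [max_eq_left h, max_eq_right (by linarith)]; ring
  rw [h3, h1] at h2
  linarith

/-- The squared norm of the projection of `h` onto the cone of vectors whose components indexed by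
`Fin m₂` are nonnegative. -/
noncomputable def projSq {m₁ m₂ : ℕ} (h : Fin m₁ ⊕ Fin m₂ → ℝ) : ℝ :=
  ∑ i, h (Sum.inl i) ^ 2 + ∑ i, (max (h (Sum.inr i)) 0) ^ 2

/-- Chebyshev's inequality for a sum of independent terms. That `v` does not depend on the
dimensions is what matters: with `δ` of order `n` the bound is `O(1 / n)`. -/
lemma exists_measure_projSq_le : ∃ v : ℝ, 0 ≤ v ∧ ∀ (m₁ m₂ : ℕ) (δ : ℝ), 0 < δ →
    stdGaussianPi (Fin m₁ ⊕ Fin m₂) {h | (m₁ : ℝ) + m₂ / 2 + δ ≤ projSq h} ≤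
      ENNReal.ofReal (v * (m₁ + m₂) / δ ^ 2) := by
  let a : ℝ → ℝ := fun t => t ^ 2
  let b : ℝ → ℝ := fun t => (max t 0) ^ 2
  let va := Var[a; gaussianReal 0 1]
  let vb := Var[b; gaussianReal 0 1]
  have hva : 0 ≤ va := variance_nonneg _ _
  have hvb : 0 ≤ vb := variance_nonneg _ _
  refine ⟨va + vb, by positivity, fun m₁ m₂ δ hδ => ?_⟩
  let X : Fin m₁ ⊕ Fin m₂ → ℝ → ℝ := Sum.elim (fun _ => a) (fun _ => b)
  have hX (r) : MemLp (X r) 2 (gaussianReal 0 1) := by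
    rcases r with r | r
    · exact memLp_sq_gaussianReal
    · exact memLp_sq_posPart_gaussianReal
  have hX' (r) : MemLp (fun h : Fin m₁ ⊕ Fin m₂ → ℝ => X r (h r)) 2 (stdGaussianPi _) :=
    (hX r).comp_measurePreserving (measurePreserving_eval (fun _ => gaussianReal 0 1) r)
  have hproj : (projSq : (Fin m₁ ⊕ Fin m₂ → ℝ) → ℝ) = ∑ r, fun h => X r (h r) := by
    funext h
    simp [projSq, Finset.sum_apply, X, a, b]
  have hvar : Var[projSq; stdGaussianPi (Fin m₁ ⊕ Fin m₂)] = m₁ * va + m₂ * vb := by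
    rw [hproj, variance_sum_pi hX]
    simp [X, va, vb]
  have hmean : ∫ h, projSq h ∂stdGaussianPi (Fin m₁ ⊕ Fin m₂) = (m₁ : ℝ) + m₂ / 2 := by
    have hev (r) : ∫ h, X r (h r) ∂stdGaussianPi (Fin m₁ ⊕ Fin m₂) =
        ∫ t, X r t ∂gaussianReal 0 1 := by
      have mp := measurePreserving_eval (fun _ : Fin m₁ ⊕ Fin m₂ => gaussianReal 0 1) r
      conv_rhs => rw [← mp.map_eq]
      rw [integral_map mp.aemeasurable (by rw [mp.map_eq]; exact (hX r).1)]
    rw [hproj]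
    simp only [Finset.sum_apply]
    rw [integral_finsetSum _ fun r _ => (hX' r).integrable (by norm_num)]
    simp only [hev, Fintype.sum_sum_type, X, Sum.elim_inl, Sum.elim_inr, a, b,
      integral_sq_gaussianReal, integral_sq_posPart_gaussianReal]
    simp [div_eq_mul_inv]
  have hmem : MemLp projSq 2 (stdGaussianPi (Fin m₁ ⊕ Fin m₂)) := by
    rw [hproj]
    exact memLp_finsetSum' _ fun r _ => hX' r
  refine (measure_mono fun h hh => ?_).trans
    ((meas_ge_le_variance_div_sq hmem hδ).trans (ENNReal.ofReal_le_ofReal ?_))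
  · rw [Set.mem_ofPred_eq] at hh ⊢
    rw [hmean]
    exact (by linarith : δ ≤ _).trans (le_abs_self _)
  · rw [hvar]
    gcongr
    have h1 : (0 : ℝ) ≤ m₁ * vb := by positivity
    have h2 : (0 : ℝ) ≤ m₂ * va := by positivity
    linarith

lemma tendsto_measure_projSq {m₁ m₂ : ℕ → ℕ} {α₁ α₂ : ℝ}
    (hm₁ : Tendsto (fun n : ℕ => (m₁ n : ℝ) / n) atTop (𝓝 α₁))
    (hm₂ : Tendsto (fun n : ℕ => (m₂ n : ℝ) / n) atTop (𝓝 α₂)) {c : ℝ} (hc : 0 < c) :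
    Tendsto (fun n : ℕ => stdGaussianPi (Fin (m₁ n) ⊕ Fin (m₂ n))
      {h | (m₁ n : ℝ) + m₂ n / 2 + c * n ≤ projSq h}) atTop (𝓝 0) := by
  obtain ⟨v, hv, hle⟩ := exists_measure_projSq_le
  have hlim : Tendsto (fun n : ℕ => ENNReal.ofReal
      (v / c ^ 2 * ((m₁ n : ℝ) / n + (m₂ n : ℝ) / n) * (n : ℝ)⁻¹)) atTop (𝓝 0) := by
    rw [← ENNReal.ofReal_zero]
    refine ENNReal.tendsto_ofReal ?_
    simpa using ((hm₁.add hm₂).const_mul (v / c ^ 2)).mul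
      (tendsto_inv_atTop_nhds_zero_nat (𝕜 := ℝ))
  refine tendsto_of_tendsto_of_tendsto_of_le_of_le' tendsto_const_nhds hlim
    (Eventually.of_forall fun _ => zero_le) ?_
  filter_upwards [eventually_gt_atTop 0] with n hn
  have hn' : (0 : ℝ) < n := by exact_mod_cast hn
  refine (hle _ _ (c * n) (by positivity)).trans (ENNReal.ofReal_le_ofReal (le_of_eq ?_))
  field_simp

/-- Against nonnegative components of `y`, replacing `h` by its positive part only increases the
sum; then Cauchy–Schwarz. This is why an inequality constraint counts half as much as an equality.
-/
lemma dotProduct_le_sqrt_projSq {m₁ m₂ : ℕ} (h y : Fin m₁ ⊕ Fin m₂ → ℝ)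
    (hy : ∀ i, 0 ≤ y (Sum.inr i)) :
    ∑ r, h r * y r ≤ √(projSq h) * √(y ⬝ᵥ y) := by
  let h' : Fin m₁ ⊕ Fin m₂ → ℝ := Sum.elim (fun i => h (Sum.inl i)) fun i => max (h (Sum.inr i)) 0
  have h1 : projSq h = h' ⬝ᵥ h' := by
    simp [projSq, dotProduct, h', pow_two]
  rw [h1]
  refine le_trans ?_ (dotProduct_le_sqrt_mul_sqrt h' y)
  refine Finset.sum_le_sum fun r _ => ?_
  rcases r with r | r
  · exact le_rfl
  · exact mul_le_mul_of_nonneg_right (le_max_left _ _) (hy r)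

end Concentration

/-! ### From finite index sets to all multipliers and all points. -/

section FixedDimension

variable {m₁ m₂ n : ℕ}

instance isProbabilityMeasure_gaussianVector : IsProbabilityMeasure (gaussianVector n) := by
  unfold gaussianVector; infer_instance

instance isProbabilityMeasure_gaussianMatrix : IsProbabilityMeasure (gaussianMatrix m₁ n) := by
  unfold gaussianMatrix; infer_instance

instance isProbabilityMeasure_gaussianPair : IsProbabilityMeasure (gaussianPair m₁ m₂ n) := by
  unfold gaussianPair; infer_instance

lemma lagrangian_eq_sum (f : EuclideanSpace ℝ (Fin n) → ℝ)
    (C : (Fin m₁ → Fin n → ℝ) × (Fin m₂ → Fin n → ℝ)) (x : EuclideanSpace ℝ (Fin n))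
    (ν : Fin m₁ → ℝ) (l : Fin m₂ → ℝ) :
    lagrangian f (Matrix.of C.1) (Matrix.of C.2) x ν l = f x +
      ((∑ i, ν i * ∑ s, C.1 i s * x.ofLp s) + ∑ i, l i * ∑ s, C.2 i s * x.ofLp s) := by
  simp only [lagrangian, dotProduct, Matrix.mulVec, Matrix.of_apply, add_assoc]

lemma continuous_lagrangian (f : EuclideanSpace ℝ (Fin n) → ℝ)
    (x : EuclideanSpace ℝ (Fin n)) :
    Continuous fun p : ((Fin m₁ → Fin n → ℝ) × (Fin m₂ → Fin n → ℝ)) ×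
        ((Fin m₁ → ℝ) × (Fin m₂ → ℝ)) =>
      lagrangian f (Matrix.of p.1.1) (Matrix.of p.1.2) x p.2.1 p.2.2 := by
  simp only [lagrangian_eq_sum]
  fun_prop

lemma sqrt_dotProduct_self (x : EuclideanSpace ℝ (Fin n)) : √(x.ofLp ⬝ᵥ x.ofLp) = ‖x‖ := by
  rw [EuclideanSpace.norm_eq]
  simp [dotProduct, pow_two]

/-- Since `p k` does not involve `g`, each condition is either vacuous or a strict linear inequality
in `g`. Measurability is needed for continuity from above. -/
lemma measurableSet_forall_cone {ι : Type*} [Countable ι] (d : ι → EuclideanSpace ℝ (Fin n))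
    (s : ℝ) (p : ι → Prop) :
    MeasurableSet {g : Fin n → ℝ | ∀ k, ‖d k‖ * s ≤ g ⬝ᵥ (d k).ofLp → p k} := by
  simp only [Set.ofPred_forall]
  refine MeasurableSet.iInter fun j => ?_
  by_cases h : p j
  · simp [h]
  · simp only [h, imp_false, not_le]
    refine measurableSet_lt ?_ measurable_const
    unfold dotProduct
    fun_prop

lemma measure_exists_multiplier_of_finite (f : EuclideanSpace ℝ (Fin n) → ℝ) {I J : Type*}
    [Fintype I] [Fintype J] [DecidableEq I] [DecidableEq J]
    (ν : I → Fin m₁ → ℝ) (l : I → Fin m₂ → ℝ) (hl : ∀ i, 0 ≤ l i)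
    (x : J → EuclideanSpace ℝ (Fin n)) (a : ℝ) {ε s : ℝ} (hε : 0 < ε) (hs : 0 ≤ s) :
    gaussianPair m₁ m₂ n {C | ∃ i, ∀ j, a + ε <
        lagrangian f (Matrix.of C.1) (Matrix.of C.2) (x j) (ν i) (l i)} *
        gaussianReal 0 1 (Set.Ioi 0) ≤
      gaussianVector n {g | ∀ j, ‖x j‖ * s ≤ g ⬝ᵥ (x j).ofLp → a < f (x j)} +
      stdGaussianPi (Fin m₁ ⊕ Fin m₂) {h | s ^ 2 ≤ projSq h} := by
  let y : I → Fin m₁ ⊕ Fin m₂ → ℝ := fun i => Sum.elim (ν i) (l i)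
  set B : Set ((Fin m₁ → Fin n → ℝ) × (Fin m₂ → Fin n → ℝ)) := {C | ∃ i, ∀ j, a + ε <
        lagrangian f (Matrix.of C.1) (Matrix.of C.2) (x j) (ν i) (l i)} with hB
  have hBm : MeasurableSet B := by
    rw [hB]
    simp only [Set.ofPred_exists, Set.ofPred_forall]
    refine MeasurableSet.iUnion fun i => MeasurableSet.iInter fun j =>
      measurableSet_lt measurable_const ?_
    exact ((continuous_lagrangian f (x j)).comp
      (continuous_id.prodMk continuous_const : Continuous fun C => (C, (ν i, l i)))).measurable
  have mpC := measurePreserving_pair_corner m₁ m₂ n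
  rw [← Measure.prod_prod, ← mpC.measure_preimage (hBm.prod measurableSet_Ioi).nullMeasurableSet]
  have key := measure_bilinear_le_measure_linear y (fun j => (x j).ofLp) (fun j => a - f (x j)) hε
  have heh : Function.Injective fun r : Fin m₁ ⊕ Fin m₂ =>
      ((some r, none) : Option (Fin m₁ ⊕ Fin m₂) × Option (Fin n)) := by
    intro r r' h; simpa using h
  have heg : Function.Injective fun r : Fin n =>
      ((none, some r) : Option (Fin m₁ ⊕ Fin m₂) × Option (Fin n)) := by
    intro r r' h; simpa using h
  have mph := measurePreserving_comp_injective heh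
  have mpg := measurePreserving_comp_injective heg
  have hHm : MeasurableSet {h : Fin m₁ ⊕ Fin m₂ → ℝ | s ^ 2 ≤ projSq h} := by
    refine measurableSet_le measurable_const ?_
    unfold projSq
    fun_prop
  have hGm : MeasurableSet {g : Fin n → ℝ | ∀ j, ‖x j‖ * s ≤ g ⬝ᵥ (x j).ofLp → a < f (x j)} :=
    measurableSet_forall_cone x s _
  rw [gaussianVector, ← mpg.measure_preimage hGm.nullMeasurableSet,
    ← mph.measure_preimage hHm.nullMeasurableSet]
  refine (measure_mono ?_).trans (key.trans ((measure_mono ?_).trans (measure_union_le _ _)))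
  · rintro w ⟨⟨i, hi⟩, hw⟩
    refine ⟨i, fun j => ?_⟩
    have h1 := hi j
    rw [lagrangian_eq_sum] at h1
    -- A positive corner variable can only raise the bilinear process.
    have h2 : 0 ≤ √((x j).ofLp ⬝ᵥ (x j).ofLp) * √(y i ⬝ᵥ y i) * w (none, none) :=
      mul_nonneg (by positivity) (le_of_lt hw)
    rw [Fintype.sum_sum_type]
    simp only [y, Sum.elim_inl, Sum.elim_inr] at h1 h2 ⊢
    linarith
  · rintro w ⟨i, hi⟩
    by_contra hcon
    simp only [Set.mem_union, Set.mem_preimage, Set.mem_ofPred_eq, not_or, not_forall, not_le,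
      not_lt] at hcon
    -- At this point `‖x‖ hᵀ y ≤ ‖y‖ ‖x‖ s ≤ ‖y‖ gᵀ x`, so the linear process is nonpositive, yet it
    -- exceeds `a - f x ≥ 0`.
    obtain ⟨⟨j, hj, hfj⟩, hh⟩ := hcon
    have h1 := hi j
    have h2 := dotProduct_le_sqrt_projSq (fun r => w (some r, none)) (y i) fun k => hl i k
    have h3 : √(projSq fun r => w (some r, none)) ≤ s := by
      rw [← Real.sqrt_sq hs]
      exact Real.sqrt_le_sqrt hh.le
    have h4 : √((x j).ofLp ⬝ᵥ (x j).ofLp) = ‖x j‖ := sqrt_dotProduct_self _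
    rw [h4] at h1
    have h5 : (∑ r, w (some r, none) * y i r) ≤ s * √(y i ⬝ᵥ y i) :=
      h2.trans (mul_le_mul_of_nonneg_right h3 (Real.sqrt_nonneg _))
    have h6 := mul_le_mul_of_nonneg_left h5 (norm_nonneg (x j))
    have h7 := mul_le_mul_of_nonneg_left hj (Real.sqrt_nonneg (y i ⬝ᵥ y i))
    simp only [dotProduct] at h1 h6 h7
    nlinarith

/-- With finitely many points the condition is open in the multiplier, so a dense sequence in `l ≥
0` suffices, exhausted by its initial segments. Hence multipliers are treated before points. -/
lemma measure_exists_multiplier_of_finite_points (f : EuclideanSpace ℝ (Fin n) → ℝ) {J : Type*}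
    [Fintype J] [DecidableEq J] (x : J → EuclideanSpace ℝ (Fin n)) (a : ℝ) {ε s : ℝ}
    (hε : 0 < ε) (hs : 0 ≤ s) :
    gaussianPair m₁ m₂ n {C | ∃ ν l, 0 ≤ l ∧ ∀ j, a + ε <
        lagrangian f (Matrix.of C.1) (Matrix.of C.2) (x j) ν l} *
        gaussianReal 0 1 (Set.Ioi 0) ≤
      gaussianVector n {g | ∀ j, ‖x j‖ * s ≤ g ⬝ᵥ (x j).ofLp → a < f (x j)} +
      stdGaussianPi (Fin m₁ ⊕ Fin m₂) {h | s ^ 2 ≤ projSq h} := by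
  let T := {y : (Fin m₁ → ℝ) × (Fin m₂ → ℝ) // 0 ≤ y.2}
  have : Nonempty T := ⟨⟨0, le_rfl⟩⟩
  let t : ℕ → T := TopologicalSpace.denseSeq T
  let S : ℕ → Set ((Fin m₁ → Fin n → ℝ) × (Fin m₂ → Fin n → ℝ)) := fun k =>
    {C | ∃ i : Fin k, ∀ j, a + ε <
      lagrangian f (Matrix.of C.1) (Matrix.of C.2) (x j) (t i).1.1 (t i).1.2}
  have hS : Monotone S := fun k k' hk C ⟨i, hi⟩ => ⟨Fin.castLE hk i, hi⟩
  have hsub : {C : (Fin m₁ → Fin n → ℝ) × (Fin m₂ → Fin n → ℝ) | ∃ ν l, 0 ≤ l ∧ ∀ j, a + ε <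
      lagrangian f (Matrix.of C.1) (Matrix.of C.2) (x j) ν l} ⊆ ⋃ k, S k := by
    rintro C ⟨ν, l, hl, h⟩
    have hopen : IsOpen {y : T | ∀ j, a + ε <
        lagrangian f (Matrix.of C.1) (Matrix.of C.2) (x j) y.1.1 y.1.2} := by
      simp only [Set.ofPred_forall]
      refine isOpen_iInter_of_finite fun j => isOpen_lt continuous_const ?_
      exact (continuous_lagrangian f (x j)).comp
        (continuous_const.prodMk continuous_subtype_val : Continuous fun y : T => (C, y.1))
    obtain ⟨k, hk⟩ := (TopologicalSpace.denseRange_denseSeq T).exists_mem_open hopen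
      ⟨⟨(ν, l), hl⟩, h⟩
    exact Set.mem_iUnion.2 ⟨k + 1, ⟨Fin.last k, hk⟩⟩
  refine (mul_le_mul_left (measure_mono hsub) _).trans ?_
  rw [hS.measure_iUnion, ENNReal.iSup_mul]
  exact iSup_le fun k => measure_exists_multiplier_of_finite f (fun i : Fin k => (t i).1.1)
    (fun i => (t i).1.2) (fun i => (t i).2) x a hε hs

/-- Testing fewer points enlarges the event on the left, so only the event for `g` has to pass to
the limit, by continuity from above. -/
lemma measure_exists_multiplier_of_seq (f : EuclideanSpace ℝ (Fin n) → ℝ)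
    (d : ℕ → EuclideanSpace ℝ (Fin n)) (a : ℝ) {ε s : ℝ} (hε : 0 < ε) (hs : 0 ≤ s) :
    gaussianPair m₁ m₂ n {C | ∃ ν l, 0 ≤ l ∧ ∀ x, a + ε <
        lagrangian f (Matrix.of C.1) (Matrix.of C.2) x ν l} *
        gaussianReal 0 1 (Set.Ioi 0) ≤
      gaussianVector n {g | ∀ k, ‖d k‖ * s ≤ g ⬝ᵥ (d k).ofLp → a < f (d k)} +
      stdGaussianPi (Fin m₁ ⊕ Fin m₂) {h | s ^ 2 ≤ projSq h} := by
  let S : ℕ → Set (Fin n → ℝ) := fun K =>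
    {g | ∀ k : Fin K, ‖d k‖ * s ≤ g ⬝ᵥ (d k).ofLp → a < f (d k)}
  have hS : Antitone S := fun K K' hK g hg k => hg (Fin.castLE hK k)
  have hSm (K) : MeasurableSet (S K) :=
    measurableSet_forall_cone (fun k : Fin K => d k) s _
  have hinter : {g : Fin n → ℝ | ∀ k, ‖d k‖ * s ≤ g ⬝ᵥ (d k).ofLp → a < f (d k)} = ⋂ K, S K := by
    ext g
    simp only [Set.mem_iInter, S, Set.mem_ofPred_eq]
    exact ⟨fun h K k => h k, fun h k => h (k + 1) (Fin.last k)⟩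
  have hlim := tendsto_measure_iInter_atTop (μ := gaussianVector n)
    (fun K => (hSm K).nullMeasurableSet) hS ⟨0, measure_ne_top _ _⟩
  rw [hinter]
  refine ge_of_tendsto (hlim.add_const _) (Eventually.of_forall fun K => ?_)
  refine le_trans (mul_le_mul_left (measure_mono ?_) _)
    (measure_exists_multiplier_of_finite_points f (fun k : Fin K => d k) a hε hs)
  rintro C ⟨ν, l, hl, h⟩
  exact ⟨ν, l, hl, fun j => h _⟩

/-- A sequence whose points of the graph of `f` are dense in the graph. -/
lemma exists_seq_dense_graph (f : EuclideanSpace ℝ (Fin n) → ℝ) :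
    ∃ d : ℕ → EuclideanSpace ℝ (Fin n), (∃ k, d k = 0) ∧
      ∀ (U : Set (EuclideanSpace ℝ (Fin n) × ℝ)), IsOpen U → ∀ x, (x, f x) ∈ U →
        ∃ k, (d k, f (d k)) ∈ U := by
  let Γ := Set.range fun x => (x, f x)
  have : Nonempty Γ := ⟨⟨(0, f 0), 0, rfl⟩⟩
  let e : ℕ → Γ := TopologicalSpace.denseSeq Γ
  refine ⟨fun k => if k = 0 then 0 else (e (k - 1)).1.1, ⟨0, by simp⟩, fun U hU x hx => ?_⟩
  obtain ⟨k, hk⟩ := (TopologicalSpace.denseRange_denseSeq Γ).exists_mem_open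
    (hU.preimage continuous_subtype_val) ⟨⟨(x, f x), x, rfl⟩, hx⟩
  refine ⟨k + 1, ?_⟩
  obtain ⟨z, hz⟩ := (e k).2
  simp only [Nat.add_eq_zero_iff, one_ne_zero, and_false, if_false, Nat.add_sub_cancel]
  have h1 : (e k).1 = (z, f z) := hz.symm
  have h2 : (e k).1 ∈ U := hk
  rw [h1] at h2 ⊢
  exact h2

/-- For `x ≠ 0`, lowering `s` to `s'` makes the cone condition strict, hence open on the graph. At
the origin it is never strict, so the sequence must contain 0. -/
lemma exists_seq_mem_cone {f : EuclideanSpace ℝ (Fin n) → ℝ} {d : ℕ → EuclideanSpace ℝ (Fin n)}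
    (hd0 : ∃ k, d k = 0)
    (hd : ∀ (U : Set (EuclideanSpace ℝ (Fin n) × ℝ)), IsOpen U → ∀ x, (x, f x) ∈ U →
        ∃ k, (d k, f (d k)) ∈ U) {s s' a : ℝ} (hs : s' < s) {g : Fin n → ℝ}
    {x : EuclideanSpace ℝ (Fin n)} (hx : ‖x‖ * s ≤ g ⬝ᵥ x.ofLp) (hfx : f x < a) :
    ∃ k, ‖d k‖ * s' ≤ g ⬝ᵥ (d k).ofLp ∧ f (d k) < a := by
  by_cases h0 : x = 0
  · obtain ⟨k, hk⟩ := hd0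
    refine ⟨k, ?_, ?_⟩
    · rw [hk]; simp
    · rw [hk, ← h0]; exact hfx
  · have hlt : ‖x‖ * s' < g ⬝ᵥ x.ofLp :=
      (mul_lt_mul_of_pos_left hs (norm_pos_iff.2 h0)).trans_le hx
    have hopen : IsOpen {p : EuclideanSpace ℝ (Fin n) × ℝ |
        ‖p.1‖ * s' < g ⬝ᵥ p.1.ofLp ∧ p.2 < a} := by
      refine IsOpen.and (isOpen_lt (by fun_prop) ?_) (isOpen_lt (by fun_prop) (by fun_prop))
      unfold dotProduct
      fun_prop
    obtain ⟨k, hk⟩ := hd _ hopen x ⟨hlt, hfx⟩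
    exact ⟨k, hk.1.le, hk.2⟩

end FixedDimension

/-! ### Duality, comparison in fixed dimension and limits of probabilities. -/

section Main

variable {m₁ m₂ n : ℕ}

/-- Only the max-min half of strong duality enters. The intermediate `r` leaves room for Gordon's
margin. -/
lemma exists_multiplier_of_lt_optValue {f : EuclideanSpace ℝ (Fin n) → ℝ}
    {A : Matrix (Fin m₁) (Fin n) ℝ} {B : Matrix (Fin m₂) (Fin n) ℝ} (hSD : StrongDuality f A B)
    {t : ℝ} (ht : (t : EReal) < optValue f A B) :
    ∃ r, t < r ∧ ∃ ν l, 0 ≤ l ∧ ∀ x, r < lagrangian f A B x ν l := by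
  rw [hSD.2] at ht
  obtain ⟨ν, ht⟩ := lt_iSup_iff.1 ht
  obtain ⟨l, ht⟩ := lt_iSup_iff.1 ht
  obtain ⟨hl, ht⟩ := lt_iSup_iff.1 ht
  obtain ⟨r, h1, h2⟩ := EReal.lt_iff_exists_real_btwn.1 ht
  exact ⟨r, EReal.coe_lt_coe_iff.1 h1, ν, l, hl, fun x =>
    EReal.coe_lt_coe_iff.1 (h2.trans_le (iInf_le _ x))⟩

lemma exists_point_of_auxValue_lt {f : EuclideanSpace ℝ (Fin n) → ℝ} {ε₁ ε₅ t δ : ℝ}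
    {g : Fin n → ℝ} (h : auxValue m₁ m₂ ε₁ ε₅ f t g < (δ : EReal)) :
    ∃ x : EuclideanSpace ℝ (Fin n),
      ‖x‖ * ((1 + ε₁) * √((m₁ : ℝ) + (m₂ : ℝ) / 2) + ε₅ * √(n : ℝ)) ≤ g ⬝ᵥ x.ofLp ∧
        f x < t + δ := by
  obtain ⟨x, h⟩ := iInf_lt_iff.1 h
  obtain ⟨hx, h⟩ := iInf_lt_iff.1 h
  exact ⟨x, by linarith, by linarith [EReal.coe_lt_coe_iff.1 h]⟩

/-- Comparison in fixed dimension: weak inequality. -/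
lemma measure_lt_optValue_le (f : EuclideanSpace ℝ (Fin n) → ℝ) (t : ℝ) {ε₁ ε₅ s : ℝ}
    (hs : 0 ≤ s) (hlt : s < (1 + ε₁) * √((m₁ : ℝ) + (m₂ : ℝ) / 2) + ε₅ * √(n : ℝ)) :
    gaussianPair m₁ m₂ n {C | StrongDuality f (Matrix.of C.1) (Matrix.of C.2) ∧
        (t : EReal) < optValue f (Matrix.of C.1) (Matrix.of C.2)} *
        gaussianReal 0 1 (Set.Ioi 0) ≤
      gaussianVector n {g | auxValue m₁ m₂ ε₁ ε₅ f t g ≤ 0}ᶜ +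
      stdGaussianPi (Fin m₁ ⊕ Fin m₂) {h | s ^ 2 ≤ projSq h} := by
  obtain ⟨d, hd0, hd⟩ := exists_seq_dense_graph f
  let δ : ℕ → ℝ := fun k => 1 / ((k : ℝ) + 1)
  have hδ (k) : 0 < δ k := Nat.one_div_pos_of_nat
  let S : ℕ → Set ((Fin m₁ → Fin n → ℝ) × (Fin m₂ → Fin n → ℝ)) := fun k =>
    -- One `δ k` is Gordon's margin; the other raises the level above `t`, so that `U⁽¹⁾ ≤ 0` yields
    -- a point strictly below it.
    {C | ∃ ν l, 0 ≤ l ∧ ∀ x, t + δ k + δ k <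
        lagrangian f (Matrix.of C.1) (Matrix.of C.2) x ν l}
  have hS : Monotone S := by
    rintro k k' hk C ⟨ν, l, hl, h⟩
    refine ⟨ν, l, hl, fun x => lt_of_le_of_lt ?_ (h x)⟩
    have : δ k' ≤ δ k := Nat.one_div_le_one_div hk
    linarith
  have hsub : {C : (Fin m₁ → Fin n → ℝ) × (Fin m₂ → Fin n → ℝ) |
      StrongDuality f (Matrix.of C.1) (Matrix.of C.2) ∧
        (t : EReal) < optValue f (Matrix.of C.1) (Matrix.of C.2)} ⊆ ⋃ k, S k := by
    rintro C ⟨hSD, ht⟩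
    obtain ⟨r, hr, ν, l, hl, h⟩ := exists_multiplier_of_lt_optValue hSD ht
    obtain ⟨k, hk⟩ := exists_nat_one_div_lt (show 0 < (r - t) / 2 by linarith)
    refine Set.mem_iUnion.2 ⟨k, ν, l, hl, fun x => lt_trans ?_ (h x)⟩
    simp only [δ]
    linarith
  refine (mul_le_mul_left (measure_mono hsub) _).trans ?_
  rw [hS.measure_iUnion, ENNReal.iSup_mul]
  refine iSup_le fun k => (measure_exists_multiplier_of_seq f d (t + δ k) (hδ k) hs).trans ?_
  gcongr
  intro g hg hmem
  have h0 : auxValue m₁ m₂ ε₁ ε₅ f t g < (δ k : EReal) :=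
    lt_of_le_of_lt hmem (EReal.coe_lt_coe_iff.2 (hδ k))
  obtain ⟨x, hx, hfx⟩ := exists_point_of_auxValue_lt h0
  obtain ⟨j, hj, hfj⟩ := exists_seq_mem_cone hd0 hd hlt hx hfx
  exact absurd (hg j hj) (not_lt.2 hfj.le)

/-- Comparison in fixed dimension: strict inequality. -/
lemma measure_le_optValue_le (f : EuclideanSpace ℝ (Fin n) → ℝ) (t : ℝ) {ε₁ ε₅ s : ℝ}
    (hs : 0 ≤ s) (hlt : s < (1 + ε₁) * √((m₁ : ℝ) + (m₂ : ℝ) / 2) + ε₅ * √(n : ℝ)) :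
    gaussianPair m₁ m₂ n {C | StrongDuality f (Matrix.of C.1) (Matrix.of C.2) ∧
        (t : EReal) ≤ optValue f (Matrix.of C.1) (Matrix.of C.2)} *
        gaussianReal 0 1 (Set.Ioi 0) ≤
      gaussianVector n {g | auxValue m₁ m₂ ε₁ ε₅ f t g < 0}ᶜ +
      stdGaussianPi (Fin m₁ ⊕ Fin m₂) {h | s ^ 2 ≤ projSq h} := by
  obtain ⟨d, hd0, hd⟩ := exists_seq_dense_graph f
  let δ : ℕ → ℝ := fun k => 1 / ((k : ℝ) + 1)
  have hδ (k) : 0 < δ k := Nat.one_div_pos_of_nat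
  let S : ℕ → Set (Fin n → ℝ) := fun k =>
    -- With level `t - 2 * δ k` and margin `δ k`, the Lagrangian has to exceed `t - δ k`, which `t ≤
    -- ξ` allows; the limit in `k` is taken on the side of `g`.
    {g | ∀ j, ‖d j‖ * s ≤ g ⬝ᵥ (d j).ofLp → t - 2 * δ k < f (d j)}
  have hS : Antitone S := by
    intro k k' hk g hg j hj
    have h1 : δ k' ≤ δ k := Nat.one_div_le_one_div hk
    have := hg j hj
    linarith
  have hlim := tendsto_measure_iInter_atTop (μ := gaussianVector n)
    (fun k => (measurableSet_forall_cone d s fun j => t - 2 * δ k < f (d j)).nullMeasurableSet)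
    hS ⟨0, measure_ne_top _ _⟩
  have hsub : (⋂ k, S k) ⊆ {g | auxValue m₁ m₂ ε₁ ε₅ f t g < 0}ᶜ := by
    intro g hg hmem
    have hmem' : auxValue m₁ m₂ ε₁ ε₅ f t g < ((0 : ℝ) : EReal) := hmem
    obtain ⟨x, hx, hfx⟩ := exists_point_of_auxValue_lt hmem'
    obtain ⟨j, hj, hfj⟩ := exists_seq_mem_cone hd0 hd hlt hx hfx
    obtain ⟨k, hk⟩ := exists_nat_one_div_lt (show 0 < (t - f (d j)) / 2 by linarith)
    have h1 : t - 2 * δ k < f (d j) := Set.mem_iInter.1 hg k j hj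
    simp only [δ] at h1
    linarith
  refine le_trans ?_ (add_le_add_left (measure_mono hsub) _)
  refine ge_of_tendsto (hlim.add_const _) (Eventually.of_forall fun k => ?_)
  refine le_trans (mul_le_mul_left (measure_mono ?_) _)
    (measure_exists_multiplier_of_seq f d (t - 2 * δ k) (hδ k) hs)
  rintro C ⟨hSD, ht⟩
  have h1 : ((t - δ k : ℝ) : EReal) < optValue f (Matrix.of C.1) (Matrix.of C.2) :=
    lt_of_lt_of_le (EReal.coe_lt_coe_iff.2 (by linarith [hδ k])) ht
  obtain ⟨r, hr, ν, l, hl, h⟩ := exists_multiplier_of_lt_optValue hSD h1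
  exact ⟨ν, l, hl, fun x => lt_trans (by linarith) (h x)⟩

lemma WithOverwhelmingProbability.tendsto_compl {Ω : ℕ → Type} [∀ n, MeasurableSpace (Ω n)]
    {P : ∀ n, Measure (Ω n)} {E : ∀ n, Set (Ω n)} (h : WithOverwhelmingProbability P E) :
    Tendsto (fun n => P n (E n)ᶜ) atTop (𝓝 0) := by
  obtain ⟨c, hc, h⟩ := h
  have hlim : Tendsto (fun n : ℕ => ENNReal.ofReal (Real.exp (-(c * n)))) atTop (𝓝 0) := by
    rw [← ENNReal.ofReal_zero]
    refine ENNReal.tendsto_ofReal (Real.tendsto_exp_neg_atTop_nhds_zero.comp ?_)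
    exact tendsto_natCast_atTop_atTop.const_mul_atTop hc
  exact tendsto_of_tendsto_of_tendsto_of_le_of_le' tendsto_const_nhds hlim
    (Eventually.of_forall fun _ => zero_le) h

lemma tendsto_measure_one_of_compl {Ω : ℕ → Type} [∀ n, MeasurableSpace (Ω n)]
    {P : ∀ n, Measure (Ω n)} [∀ n, IsProbabilityMeasure (P n)] {E : ∀ n, Set (Ω n)}
    (h : Tendsto (fun n => P n (E n)ᶜ) atTop (𝓝 0)) :
    Tendsto (fun n => P n (E n)) atTop (𝓝 1) := by
  have hlim : Tendsto (fun n => 1 - P n (E n)ᶜ) atTop (𝓝 1) := by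
    simpa using ENNReal.Tendsto.sub tendsto_const_nhds h (Or.inl ENNReal.one_ne_top)
  refine tendsto_of_tendsto_of_tendsto_of_le_of_le hlim tendsto_const_nhds (fun n => ?_)
    fun n => prob_le_one
  -- Subadditivity suffices, so the events need not be measurable.
  rw [tsub_le_iff_right, ← measure_univ (μ := P n), ← Set.union_compl_self (E n)]
  exact measure_union_le _ _

/-- If the events `E n` fail with probability controlled, up to a fixed positive factor, by
vanishing quantities on a set of asymptotically full measure, then their probability tends to one. -/
lemma tendsto_measure_one_of_mul_le {Ω : ℕ → Type} [∀ n, MeasurableSpace (Ω n)]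
    {P : ∀ n, Measure (Ω n)} [∀ n, IsProbabilityMeasure (P n)] {E D : ∀ n, Set (Ω n)}
    (hD : Tendsto (fun n => P n (D n)ᶜ) atTop (𝓝 0)) {c : ENNReal} (hc : c ≠ 0)
    (hc' : c ≠ ⊤) {b : ℕ → ENNReal} (hb : Tendsto b atTop (𝓝 0))
    (hle : ∀ᶠ n in atTop, P n (D n ∩ (E n)ᶜ) * c ≤ b n) :
    Tendsto (fun n => P n (E n)) atTop (𝓝 1) := by
  refine tendsto_measure_one_of_compl ?_
  have hlim : Tendsto (fun n => P n (D n)ᶜ + b n / c) atTop (𝓝 0) := by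
    simpa using hD.add (ENNReal.Tendsto.div_const hb (Or.inr hc))
  refine tendsto_of_tendsto_of_tendsto_of_le_of_le' tendsto_const_nhds hlim
    (Eventually.of_forall fun _ => zero_le) ?_
  filter_upwards [hle] with n hn
  calc P n (E n)ᶜ ≤ P n ((D n)ᶜ ∪ (D n ∩ (E n)ᶜ)) := by
        refine measure_mono fun w hw => ?_
        by_cases h : w ∈ D n
        · exact Or.inr ⟨h, hw⟩
        · exact Or.inl h
    _ ≤ P n (D n)ᶜ + P n (D n ∩ (E n)ᶜ) := measure_union_le _ _
    _ ≤ _ := by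
        gcongr
        exact (ENNReal.le_div_iff_mul_le (Or.inl hc) (Or.inl hc')).2 hn

lemma gaussianReal_Ioi_ne_zero : gaussianReal 0 1 (Set.Ioi 0) ≠ 0 := by
  intro h
  have := gaussianReal_absolutelyContinuous' 0 one_ne_zero h
  simp at this

end Main

end RandomDuality

theorem mainTheorem2
    (α₁ α₂ : ℝ) (m₁ m₂ : ℕ → ℕ)
    (hm₁ : Tendsto (fun n : ℕ => (m₁ n : ℝ) / n) atTop (𝓝 α₁))
    (hm₂ : Tendsto (fun n : ℕ => (m₂ n : ℝ) / n) atTop (𝓝 α₂))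
    (f : ∀ n : ℕ, EuclideanSpace ℝ (Fin n) → ℝ)
    (hfin : RandomDuality.WithOverwhelmingProbability
      (fun n => RandomDuality.gaussianPair (m₁ n) (m₂ n) n)
      (fun n => {C | RandomDuality.optValue (f n) (Matrix.of C.1) (Matrix.of C.2) ≠ ⊥ ∧
        RandomDuality.optValue (f n) (Matrix.of C.1) (Matrix.of C.2) ≠ ⊤}))
    (hdual : RandomDuality.WithOverwhelmingProbability
      (fun n => RandomDuality.gaussianPair (m₁ n) (m₂ n) n)
      (fun n => {C | RandomDuality.StrongDuality (f n) (Matrix.of C.1) (Matrix.of C.2)}))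
    (ε₁ ε₅ : ℝ) (hε₁ : 0 < ε₁) (hε₅ : 0 < ε₅)
    (ξD : ℕ → ℝ)
    (hξD : RandomDuality.WithOverwhelmingProbability
      (fun n => RandomDuality.gaussianVector n)
      (fun n => {g | RandomDuality.auxValue (m₁ n) (m₂ n) ε₁ ε₅ (f n) (ξD n) g ≤ 0})) :
    Tendsto (fun n => RandomDuality.gaussianPair (m₁ n) (m₂ n) n
        {C | RandomDuality.optValue (f n) (Matrix.of C.1) (Matrix.of C.2) ≤ (ξD n : EReal)}) atTop (𝓝 1) ∧
    (RandomDuality.WithOverwhelmingProbability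
        (fun n => RandomDuality.gaussianVector n)
        (fun n => {g | RandomDuality.auxValue (m₁ n) (m₂ n) ε₁ ε₅ (f n) (ξD n) g < 0}) →
      Tendsto (fun n => RandomDuality.gaussianPair (m₁ n) (m₂ n) n
        {C | RandomDuality.optValue (f n) (Matrix.of C.1) (Matrix.of C.2) < (ξD n : EReal)}) atTop (𝓝 1)) := by
  -- Half of `ε₅` keeps `s n` strictly below the coefficient in the auxiliary program when `n > 0`;
  -- the other half makes `s n ^ 2` exceed the mean `m₁ + m₂ / 2` by at least `(ε₅ / 2) ^ 2 * n`.
  let s : ℕ → ℝ := fun n => √((m₁ n : ℝ) + (m₂ n : ℝ) / 2) + ε₅ / 2 * √(n : ℝ)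
  have hs (n) : 0 ≤ s n := by positivity
  have hlt (n : ℕ) (hn : 0 < n) :
      s n < (1 + ε₁) * √((m₁ n : ℝ) + (m₂ n : ℝ) / 2) + ε₅ * √(n : ℝ) := by
    have h1 : 0 < √(n : ℝ) := Real.sqrt_pos.2 (by exact_mod_cast hn)
    have h2 : 0 ≤ ε₁ * √((m₁ n : ℝ) + (m₂ n : ℝ) / 2) := by positivity
    have h3 : 0 < ε₅ * √(n : ℝ) := by positivity
    simp only [s]
    linarith
  have hH : Tendsto (fun n => RandomDuality.stdGaussianPi (Fin (m₁ n) ⊕ Fin (m₂ n))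
      {h | s n ^ 2 ≤ RandomDuality.projSq h}) atTop (𝓝 0) := by
    refine tendsto_of_tendsto_of_tendsto_of_le_of_le tendsto_const_nhds
      (RandomDuality.tendsto_measure_projSq hm₁ hm₂ (c := (ε₅ / 2) ^ 2) (by positivity))
      (fun _ => zero_le) fun n => measure_mono fun h hh => ?_
    refine le_trans ?_ (Set.mem_ofPred_eq ▸ hh)
    have h1 := Real.sq_sqrt (show 0 ≤ (m₁ n : ℝ) + (m₂ n : ℝ) / 2 by positivity)
    have h2 := Real.sq_sqrt (show 0 ≤ (n : ℝ) by positivity)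
    have h3 : 0 ≤ √((m₁ n : ℝ) + (m₂ n : ℝ) / 2) * (ε₅ / 2 * √(n : ℝ)) := by positivity
    have h4 : (ε₅ / 2) ^ 2 * (n : ℝ) = (ε₅ / 2 * √(n : ℝ)) ^ 2 := by rw [mul_pow, h2]
    rw [h4]
    simp only [s]
    nlinarith
  refine ⟨?_, fun hneg => ?_⟩
  · refine RandomDuality.tendsto_measure_one_of_mul_le hdual.tendsto_compl
      RandomDuality.gaussianReal_Ioi_ne_zero (measure_ne_top _ _)
      (by simpa using hξD.tendsto_compl.add hH) ?_
    filter_upwards [eventually_gt_atTop 0] with n hn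
    refine le_trans ?_ (RandomDuality.measure_lt_optValue_le (f n) (ξD n) (hs n) (hlt n hn))
    gcongr
    rintro C ⟨h1, h2⟩
    exact ⟨h1, not_le.1 h2⟩
  · refine RandomDuality.tendsto_measure_one_of_mul_le hdual.tendsto_compl
      RandomDuality.gaussianReal_Ioi_ne_zero (measure_ne_top _ _)
      (by simpa using hneg.tendsto_compl.add hH) ?_
    filter_upwards [eventually_gt_atTop 0] with n hn
    refine le_trans ?_ (RandomDuality.measure_le_optValue_le (f n) (ξD n) (hs n) (hlt n hn))
    gcongr
    rintro C ⟨h1, h2⟩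
    exact ⟨h1, not_lt.1 h2⟩
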